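/- \textbf{Setting.} Agents $1,\dots,n$ ($n\ge 1$) communicate over a connected undirected graph with a doubly stochastic matrix $A=[a_{ij}]$ such that, for some constant $c>0$, $a_{ij}>c$ whenever $j=i$ or $j$ is a neighbour of $i$, and $a_{ij}=0$ otherwise. Agent $i$ has the local cost $f_i(x)=\mathbb{E}_{\xi_i\sim\mathcal{D}_i}[\ell_i(x,\xi_i)]$ on $\mathbb{R}^d$. Each $f_i$ is differentiable, $\nabla f_i$ is $L_i$-Lipschitz ($L_i>0$), and $\langle\nabla f_i(x)-\nabla f_i(y),x-y\rangle\ge\mu\|x-y\|^2$ for all $x,y$, with a common $\mu>0$. A sampled gradient satisfies, for every fixed $x$, $\mathbb{E}[g_i(x,\xi_i)]=\nabla f_i(x)$ and $\mathbb{E}\|g_i(x,\xi_i)-\nabla f_i(x)\|^2\le\sigma_g^2$. \textbf{Algorithm 1.} From arbitrary deterministic $x_{i,0}\in\mathbb{R}^d$, each agent sends $y_{i,k}=x_{i,k}+n_{i,k}$ to its neighbours and sets $$x_{i,k+1}=(1-\beta_k)x_{i,k}+\beta_k\sum_j a_{ij}\,y_{j,k}-\frac{\alpha_k}{\gamma_k}\sum_{l=1}^{\gamma_k}g_i(x_{i,k},\xi_{i,k}^{l}).$$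 Here $\xi_{i,k}^{l}\sim\mathcal{D}_i$, and the samples drawn at different iterations are independent. All coordinates of all the noises $n_{i,k}$ are independent of each other and jointly independent of the samples; those at iteration $k$ have the zero-mean Laplace distribution with scale $\sigma_k$ (variance $2\sigma_k^2$). \textbf{Privacy.} Let $C>0$. The sensitive data $D=(D_k)_{k\ge0}$ are the sampled gradients of all agents; $D_k$ may depend (measurably) on the noisy states $y_{\cdot,0},\dots,y_{\cdot,k-1}$ exchanged before iteration $k$. Two data $D,D'$ are adjacent if there is one agent $i$ such that at every iteration, for the same exchanged noisy states, $D_k$ and $D'_k$ differ in at most one sampled gradient, which belongs to agent $i$, and there by at most $C$ in the $\ell_1$-norm. The sensitivity $\Delta_k$ is the supremum of $\|x_{j,k}-x'_{j,k}\|_1$ over all agents $j$, all adjacent $D,D'$ and all (common) exchanged noisy states, where $x$ and $x'$ are the states obtained from $D$ and $D'$. The cumulative privacy budget is $\varepsilon=\sum_{k=1}^\infty\Delta_k/\sigma_k$. The algorithm is $\varepsilon$-differentially private over infinitely many iterations if, for all adjacent $D,D'$, the output $\mathcal{A}=(y_{i,k})_{1\le i\le n,\,k\ge0}$ satisfies $\mathbb{P}\{\mathcal{A}(D)\in\Upsilon\}\le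 e^{\varepsilon}\,\mathbb{P}\{\mathcal{A}(D')\in\Upsilon\}$ for every measurable set $\Upsilon$ of output sequences, the probability being that of the noises. \textbf{Corollary 1.} Let $\alpha_k=\frac{a_1}{(k+a_2)^{\alpha}}$, $\beta_k=\frac{a_1}{(k+a_2)^{\beta}}$, $\gamma_k=\lceil a_3(k+a_2)^{\gamma}\rceil$, $\sigma_k=b(k+a_2)^{\eta}$ with $a_2,a_3,b>0$ and $0<a_1<a_2^{\beta}$. If $\alpha+\gamma-\beta+\eta>1$, $0<\beta<\alpha\le1$, $\gamma\ge0$ and $0\le\eta\le\frac{3\beta-2}{2}$, then both of the following hold (even when $\eta>0$, so that the noise variance increases): (1) there is a minimizer $x^*$ of $f=\sum_i f_i$ such that, for all $i$, $x_{i,k}$ has a finite second moment for all $k$ and $\lim_{k\to\infty}\mathbb{E}\|x_{i,k}-x^*\|^2=0$; (2) for every $C>0$, the cumulative privacy budget $\varepsilon=\sum_{k\ge1}\Delta_k/\sigma_k$ is finite, and Algorithm 1 is $\varepsilon$-differentially private over infinitely many iterations. -/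

import Mathlib

open MeasureTheory ProbabilityTheory Filter Topology
open scoped ENNReal

noncomputable section

namespace DPOpt

/-- The decision space `ℝᵈ` with its Euclidean norm. -/
abbrev Vec (d : ℕ) := EuclideanSpace ℝ (Fin d)

/-- One vector for each of the `n` agents. -/
abbrev Profile (n d : ℕ) := Fin n → Vec d

/-- The `ℓ₁` norm on `ℝᵈ`. -/
def l1Norm {d : ℕ} (v : Vec d) : ℝ := ∑ c, |v c|

/-- The zero-mean Laplace distribution with scale `b` (its variance is `2 b²`). -/
def laplace (b : ℝ) : Measure ℝ :=
  volume.withDensity fun x => ENNReal.ofReal (1 / (2 * b) * Real.exp (-|x| / b))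

/-- The local cost `x ↦ 𝔼[ℓ(x, ξ)]`, `ξ ∼ 𝒟`. -/
def localCost {d : ℕ} {S : Type*} [MeasurableSpace S] (𝒟 : Measure S) (ℓ : Vec d → S → ℝ)
    (x : Vec d) : ℝ := ∫ s, ℓ x s ∂𝒟

/-- The undirected communication graph is connected; the adjacency matrix is doubly stochastic,
its entries are bounded below by a positive constant on neighbourhoods (an agent is a neighbour of
itself), and vanish elsewhere. -/
structure IsCommunicationMatrix {n : ℕ} (G : SimpleGraph (Fin n))
    (A : Matrix (Fin n) (Fin n) ℝ) : Prop where
  connected : G.Connected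
  lower : ∃ c : ℝ, 0 < c ∧ ∀ i j, (i = j ∨ G.Adj i j) → c < A i j
  zero : ∀ i j, ¬ (i = j ∨ G.Adj i j) → A i j = 0
  doublyStochastic : A ∈ doublyStochastic ℝ (Fin n)

/-- `F` is differentiable with `L`-Lipschitz gradient and is `μ`-strongly convex. -/
structure IsSmoothStronglyConvex {d : ℕ} (F : Vec d → ℝ) (L μ : ℝ) : Prop where
  differentiable : Differentiable ℝ F
  lipschitz : ∀ x y, ‖gradient F x - gradient F y‖ ≤ L * ‖x - y‖
  strong : ∀ x y, μ * ‖x - y‖ ^ 2 ≤ inner ℝ (gradient F x - gradient F y) (x - y)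

/-- `g(x, ξ)`, `ξ ∼ 𝒟`, is an unbiased estimate of `∇F(x)` with variance at most `s²`, for each
fixed `x`. -/
structure IsStochasticGradient {d : ℕ} {S : Type*} [MeasurableSpace S] (𝒟 : Measure S)
    (F : Vec d → ℝ) (g : Vec d → S → Vec d) (s : ℝ) : Prop where
  measurable : Measurable (Function.uncurry g)
  memLp : ∀ x, MemLp (g x) 2 𝒟
  unbiased : ∀ x, ∫ z, g x z ∂𝒟 = gradient F x
  variance : ∀ x, ∫ z, ‖g x z - gradient F x‖ ^ 2 ∂𝒟 ≤ s ^ 2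

/-- `ξ k i l` is the `l`-th sample of agent `i` at iteration `k`: it has the law `𝒟 i`, and the
collections of samples drawn at different iterations are independent. -/
structure IsSampling {n : ℕ} {S : Fin n → Type*} [∀ i, MeasurableSpace (S i)]
    (𝒟 : ∀ i, Measure (S i)) {Ω : Type*} [MeasurableSpace Ω] (P : Measure Ω)
    (ξ : ℕ → ∀ i, ℕ → Ω → S i) : Prop where
  measurable : ∀ k i l, Measurable (ξ k i l)
  law : ∀ k i l, P.map (ξ k i l) = 𝒟 i
  indep : iIndepFun (fun (k : ℕ) (ω : Ω) (i : Fin n) (l : ℕ) => ξ k i l ω) P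

/-- `ν k i` is the noise of agent `i` at iteration `k`: all coordinates of all these vectors are
independent, and those at iteration `k` are Laplace with scale `σ k`. -/
structure IsLaplaceNoise {n d : ℕ} {Ω : Type*} [MeasurableSpace Ω] (P : Measure Ω)
    (σ : ℕ → ℝ) (ν : ℕ → Fin n → Ω → Vec d) : Prop where
  measurable : ∀ k i, Measurable (ν k i)
  law : ∀ k i c, P.map (fun ω => ν k i ω c) = laplace (σ k)
  indep : iIndepFun
    (fun (p : ℕ × Fin n × Fin d) (ω : Ω) => ν p.1 p.2.1 ω p.2.2) P

/-- The public parameters of the algorithm: adjacency matrix, step sizes `α_k` (gradient step) and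
`β_k` (mixing step), sample sizes `γ_k`, and initial states. -/
structure Alg (n d : ℕ) where
  A : Matrix (Fin n) (Fin n) ℝ
  gradStep : ℕ → ℝ
  mixStep : ℕ → ℝ
  batch : ℕ → ℕ
  init : Profile n d

/-- Iteration `k` of the algorithm, from the states `x`, the received noisy states `y`, and the
sampled gradients `v i l` (`l`-th sample of agent `i`):
`x_i ↦ (1 - β_k) x_i + β_k ∑_j a_{ij} y_j - α_k (1 / γ_k) ∑_{l < γ_k} v_{i,l}`. -/
def Alg.step {n d : ℕ} (a : Alg n d) (k : ℕ) (x y : Profile n d) (v : Fin n → ℕ → Vec d) :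
    Profile n d := fun i =>
  (1 - a.mixStep k) • x i + a.mixStep k • ∑ j, a.A i j • y j
    - a.gradStep k • ((1 / (a.batch k : ℝ)) • ∑ l ∈ Finset.range (a.batch k), v i l)

/-- The states `x_{i,k}` of the algorithm, for given samples `ξ k i l` and noises `ν k i`, with
sampled gradients `g_i(x_{i,k}, ξ k i l)`. -/
def Alg.iterate {n d : ℕ} (a : Alg n d) {S : Fin n → Type*} (g : ∀ i, Vec d → S i → Vec d)
    (ξ : ℕ → ∀ i, ℕ → S i) (ν : ℕ → Profile n d) : ℕ → Profile n d
  | 0 => a.init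
  | k + 1 => a.step k (a.iterate g ξ ν k) (fun j => a.iterate g ξ ν k j + ν k j)
      (fun i l => g i (a.iterate g ξ ν k i) (ξ k i l))

/-! ### Privacy -/

/-- The sensitive data: `D k h i l` is the `l`-th sampled gradient of agent `i` at iteration `k`.
As the sampled gradients are evaluated along the run, they may depend on the noisy states
`h 0, …, h (k - 1)` exchanged before (together with the data themselves and the initial states,
these determine the states up to iteration `k`). Data that do not depend on `h` are the case of
predetermined sampled gradients. -/
abbrev GradData (n d : ℕ) := ∀ k : ℕ, (Fin k → Profile n d) → Fin n → ℕ → Vec d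

/-- The state of all agents at iteration `k`, if the noisy states exchanged before were `h` and the
sampled gradients are those of `D`. -/
def Alg.state {n d : ℕ} (a : Alg n d) (D : GradData n d) :
    ∀ k : ℕ, (Fin k → Profile n d) → Profile n d
  | 0, _ => a.init
  | k + 1, h => a.step k (a.state D k (Fin.init h)) (h (Fin.last k)) (D k (Fin.init h))

/-- The noisy states exchanged before iteration `k`, for given data and noises. -/
def Alg.history {n d : ℕ} (a : Alg n d) (D : GradData n d) (ν : ℕ → Profile n d) :
    ∀ k : ℕ, Fin k → Profile n d
  | 0 => Fin.elim0
  | k + 1 => Fin.snoc (a.history D ν k) (fun j => a.state D k (a.history D ν k) j + ν k j)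

/-- The output of the algorithm over infinitely many iterations: all the noisy states
`x_{j,k} + n_{j,k}`. -/
def Alg.output {n d : ℕ} (a : Alg n d) (D : GradData n d) (ν : ℕ → Profile n d) :
    ℕ → Profile n d := fun k j => a.state D k (a.history D ν k) j + ν k j

/-- Adjacency: the data of one agent `i` differ, at each iteration, in at most one sample `l₀`, and
there by at most `C` in the `ℓ₁` norm; everything else agrees. -/
def Adjacent {n d : ℕ} (C : ℝ) (D D' : GradData n d) : Prop :=
  ∃ i : Fin n, ∀ (k : ℕ) (h : Fin k → Profile n d), ∃ l₀ : ℕ,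
    l1Norm (D k h i l₀ - D' k h i l₀) ≤ C ∧
      ∀ (j : Fin n) (l : ℕ), ¬ (j = i ∧ l = l₀) → D k h j l = D' k h j l

/-- The sensitivity `Δ_k`: the largest `ℓ₁` change of a state `x_{j,k}` between adjacent data, the
exchanged noisy states being equal. -/
def Alg.sensitivity {n d : ℕ} (a : Alg n d) (C : ℝ) (k : ℕ) : ℝ≥0∞ :=
  ⨆ (D : GradData n d) (D' : GradData n d) (_ : Adjacent C D D')
    (h : Fin k → Profile n d) (j : Fin n),
    ENNReal.ofReal (l1Norm (a.state D k h j - a.state D' k h j))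

/-- The cumulative privacy budget `∑_{k ≥ 1} Δ_k / σ_k`. -/
def Alg.budget {n d : ℕ} (a : Alg n d) (C : ℝ) (σ : ℕ → ℝ) : ℝ≥0∞ :=
  ∑' k : ℕ, a.sensitivity C (k + 1) / ENNReal.ofReal (σ (k + 1))

/-- `ε`-differential privacy of the output over infinitely many iterations, with respect to the
distribution `P` of the noises `ν`. -/
def Alg.IsDifferentiallyPrivate {n d : ℕ} (a : Alg n d) {Ω : Type*} [MeasurableSpace Ω]
    (P : Measure Ω) (ν : ℕ → Fin n → Ω → Vec d) (C ε : ℝ) : Prop :=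
  ∀ D D' : GradData n d,
    (∀ k i l, Measurable fun h => D k h i l) → (∀ k i l, Measurable fun h => D' k h i l) →
    Adjacent C D D' →
    ∀ Y : Set (ℕ → Profile n d), MeasurableSet Y →
      P {ω | a.output D (fun k j => ν k j ω) ∈ Y} ≤
        ENNReal.ofReal (Real.exp ε) * P {ω | a.output D' (fun k j => ν k j ω) ∈ Y}

/-- The states given the exchanged noisy states, when the sampled gradients are
`g_i(x_{i,k}, ξ k i l)`. -/
def Alg.sampledState {n d : ℕ} (a : Alg n d) {S : Fin n → Type*}
    (g : ∀ i, Vec d → S i → Vec d) (ξ : ℕ → ∀ i, ℕ → S i) :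
    ∀ k : ℕ, (Fin k → Profile n d) → Profile n d
  | 0, _ => a.init
  | k + 1, h => a.step k (a.sampledState g ξ k (Fin.init h)) (h (Fin.last k))
      (fun i l => g i (a.sampledState g ξ k (Fin.init h) i) (ξ k i l))

/-- The sampled gradients `g_i(x_{i,k}, ξ k i l)` as data. -/
def Alg.sampledData {n d : ℕ} (a : Alg n d) {S : Fin n → Type*}
    (g : ∀ i, Vec d → S i → Vec d) (ξ : ℕ → ∀ i, ℕ → S i) : GradData n d :=
  fun k h i l => g i (a.sampledState g ξ k h i) (ξ k i l)

theorem Alg.state_sampledData {n d : ℕ} (a : Alg n d) {S : Fin n → Type*}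
    (g : ∀ i, Vec d → S i → Vec d) (ξ : ℕ → ∀ i, ℕ → S i) (k : ℕ) (h : Fin k → Profile n d) :
    a.state (a.sampledData g ξ) k h = a.sampledState g ξ k h := by
  induction k with
  | zero => rfl
  | succ k ih => simp only [Alg.state, Alg.sampledState, ih]; rfl

/-- On the data formed by its own sampled gradients, the output consists of the noisy states
`x_{j,k} + n_{j,k}` of the algorithm. -/
theorem Alg.output_sampledData {n d : ℕ} (a : Alg n d) {S : Fin n → Type*}
    (g : ∀ i, Vec d → S i → Vec d) (ξ : ℕ → ∀ i, ℕ → S i) (ν : ℕ → Profile n d) (k : ℕ)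
    (j : Fin n) :
    a.output (a.sampledData g ξ) ν k j = a.iterate g ξ ν k j + ν k j := by
  have key : ∀ k, a.sampledState g ξ k (a.history (a.sampledData g ξ) ν k)
      = a.iterate g ξ ν k := by
    intro k
    induction k with
    | zero => rfl
    | succ k ih =>
      simp only [Alg.sampledState, Alg.history, Alg.iterate, Fin.init_snoc, Fin.snoc_last,
        Alg.state_sampledData, ih]
  simp only [Alg.output, Alg.state_sampledData, key]

end DPOpt

end

open DPOpt

/-! Privacy. Given the noisy states exchanged so far, the next output is a deterministic vector plus
fresh Laplace noise, so replacing `D` by `D'` changes its conditional law by a factor at most `exp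
(‖state change‖₁ / σ_k)` (`laplacePdf_sub_le`). The noise of round `k` is independent of the past,
hence these factors multiply over the rounds although the data adapt to the history
(`lintegral_history_le`), and an approximation by cylinders reaches events on infinite outputs. With
the exchanged states held equal, only the agent whose gradients differ can have a changed state, and
the mixing terms cancel. The change therefore obeys `s_{k+1} ≤ (1 - β_k) s_k + α_k C / γ_k`. As `β <
1`, contraction beats the drift of powers and `s_k = O(k ^ (-(α + γ - β)))`; division by `σ_k` gives
a series with exponent `α + γ - β + η > 1`.

Convergence. Let `p` be the zero of `∑ ∇f_i`, and follow the total squared distance `W_k = ∑_i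
𝔼‖x_{i,k} - p‖²` directly, without splitting it into consensus error and mean. The difficulty is
that the single `∇f_i(p)` do not vanish and create a cross term of order `α_k`. Since they sum to
zero, this term sees only the disagreement between agents: it is at most a constant times `α_k √D`,
with `D` the Dirichlet form of the graph. Mixing dissipates about `β_k D`, and Young's inequality
leaves only `α_k² / β_k` (`exists_sum_norm_step_sq_le`). Laplace noise and gradient errors have mean
zero given the current state, so they add only their second moments. Altogether `W_{k+1} ≤ (1 - 2 μ
α_k + B α_k²) W_k + B (α_k² / β_k + α_k² + β_k² σ_k²)`. Here `∑ α_k = ∞` because `α ≤ 1`, and the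
source divided by `α_k` tends to zero: the first quotient because `β < α`, the last because `2η ≤ 3β
- 2` makes its exponent at most `α + β - 2 < 0`. Thus `W_k → 0`. -/

/-! ### The Laplace distribution -/

/-- The density of the Laplace distribution. -/
noncomputable def laplacePdf (b x : ℝ) : ℝ := 1 / (2 * b) * Real.exp (-|x| / b)

theorem laplacePdf_nonneg {b : ℝ} (hb : 0 < b) (x : ℝ) : 0 ≤ laplacePdf b x := by
  unfold laplacePdf; positivity

theorem measurable_laplacePdf (b : ℝ) : Measurable (laplacePdf b) := by
  unfold laplacePdf; fun_prop

theorem laplace_eq_withDensity (b : ℝ) :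
    laplace b = volume.withDensity fun x => ENNReal.ofReal (laplacePdf b x) := rfl

theorem lintegral_laplace (b : ℝ) {F : ℝ → ℝ≥0∞} (hF : Measurable F) :
    ∫⁻ x, F x ∂laplace b = ∫⁻ x, ENNReal.ofReal (laplacePdf b x) * F x := by
  rw [laplace_eq_withDensity, lintegral_withDensity_eq_lintegral_mul _
    (measurable_laplacePdf b).ennreal_ofReal hF]
  rfl

/-- Evenness folds the integral onto the half-line, where it is a value of `Γ(3) = 2`. -/
theorem integral_sq_mul_laplacePdf {b : ℝ} (hb : 0 < b) :
    ∫ x, laplacePdf b x * x ^ 2 = 2 * b ^ 2 := by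
  have h1 : ∀ x, laplacePdf b x * x ^ 2
      = (fun y : ℝ => 1 / (2 * b) * (y ^ (2 : ℝ) * Real.exp (-(b⁻¹ * y)))) |x| := by
    intro x
    simp only [laplacePdf, Real.rpow_two, sq_abs]
    rw [show -(b⁻¹ * |x|) = -|x| / b by field_simp]
    ring
  simp_rw [h1]
  rw [integral_comp_abs (f := fun y : ℝ => 1 / (2 * b) * (y ^ (2 : ℝ) * Real.exp (-(b⁻¹ * y)))),
    integral_const_mul]
  have h2 := Real.integral_rpow_mul_exp_neg_mul_Ioi (a := 3) (r := b⁻¹) (by norm_num)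
    (inv_pos.2 hb)
  rw [show (3 : ℝ) - 1 = 2 by norm_num] at h2
  rw [h2]
  have h3 : Real.Gamma 3 = 2 := by
    rw [show (3 : ℝ) = ((2 : ℕ) : ℝ) + 1 by norm_num, Real.Gamma_nat_eq_factorial]
    norm_num [Nat.factorial]
  rw [h3, show (1 / b⁻¹) = b by simp, show (3 : ℝ) = ((3 : ℕ) : ℝ) by norm_num, Real.rpow_natCast]
  field_simp

theorem lintegral_sq_laplace {b : ℝ} (hb : 0 < b) :
    ∫⁻ x, ENNReal.ofReal (x ^ 2) ∂laplace b = ENNReal.ofReal (2 * b ^ 2) := by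
  have h := integral_sq_mul_laplacePdf hb
  rw [lintegral_laplace b (by fun_prop), ← h, ofReal_integral_eq_lintegral_ofReal]
  · exact lintegral_congr fun x => (ENNReal.ofReal_mul (laplacePdf_nonneg hb x)).symm
  -- A non-integrable function has integral zero by convention, so the nonzero value already found
  -- forces integrability.
  · apply Integrable.of_integral_ne_zero
    rw [h]; positivity
  · exact Eventually.of_forall fun x => mul_nonneg (laplacePdf_nonneg hb x) (sq_nonneg x)

theorem integral_id_laplace {b : ℝ} (hb : 0 < b) : ∫ x, x ∂laplace b = 0 := by
  rw [laplace_eq_withDensity, integral_withDensity_eq_integral_toReal_smul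
    (measurable_laplacePdf b).ennreal_ofReal (by simp)]
  simp only [smul_eq_mul, ENNReal.toReal_ofReal (laplacePdf_nonneg hb _)]
  have h := integral_neg_eq_self (fun x : ℝ => laplacePdf b x * x) volume
  have h2 : ∀ x, laplacePdf b (-x) * (-x) = -(laplacePdf b x * x) := fun x => by
    simp [laplacePdf]
  simp_rw [h2, integral_neg] at h
  linarith

/-- The triangle inequality in the exponent. This is the only property of the Laplace law that
privacy uses beyond independence. -/
theorem laplacePdf_sub_le {b : ℝ} (hb : 0 < b) (s t x : ℝ) :
    laplacePdf b (x - s) ≤ Real.exp (|s - t| / b) * laplacePdf b (x - t) := by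
  unfold laplacePdf
  rw [mul_left_comm, ← Real.exp_add]
  gcongr
  rw [← add_div]
  gcongr
  have := abs_sub_le x s t
  linarith

theorem laplace_map_add_le {b : ℝ} (hb : 0 < b) (s t : ℝ) :
    (laplace b).map (fun x => s + x) ≤
      ENNReal.ofReal (Real.exp (|s - t| / b)) • (laplace b).map (fun x => t + x) := by
  have key : ∀ (r : ℝ) (T : Set ℝ), MeasurableSet T → (laplace b).map (fun x => r + x) T
      = ∫⁻ x, ENNReal.ofReal (laplacePdf b (x - r)) * T.indicator 1 x := by
    intro r T hT
    have hF : Measurable (T.indicator (1 : ℝ → ℝ≥0∞)) := measurable_one.indicator hT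
    rw [← lintegral_indicator_one hT, lintegral_map hF (by fun_prop),
      lintegral_laplace b (F := fun x => T.indicator 1 (r + x)) (hF.comp (by fun_prop)),
      ← lintegral_add_left_eq_self
        (fun x => ENNReal.ofReal (laplacePdf b (x - r)) * T.indicator 1 x) r]
    simp only [add_sub_cancel_left]
  rw [Measure.le_iff]
  intro T hT
  rw [Measure.smul_apply, key s T hT, key t T hT, smul_eq_mul, ← lintegral_const_mul']
  · refine lintegral_mono fun x => ?_
    simp only
    rw [← mul_assoc, ← ENNReal.ofReal_mul (Real.exp_nonneg _)]
    gcongr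
    exact laplacePdf_sub_le hb s t x
  · exact ENNReal.ofReal_ne_top

/-- `OuterMeasure.pi` is the largest outer measure dominated by the product on boxes, so a
comparison on boxes suffices. -/
theorem MeasureTheory.Measure.pi_mono_measure {ι : Type*} [Fintype ι] {X : ι → Type*}
    [∀ i, MeasurableSpace (X i)] {μ ν : ∀ i, Measure (X i)} [∀ i, SigmaFinite (μ i)]
    (h : ∀ i, μ i ≤ ν i) : Measure.pi μ ≤ Measure.pi ν := by
  rw [Measure.le_iff]
  intro s hs
  rw [Measure.pi, Measure.pi, toMeasure_apply _ _ hs, toMeasure_apply _ _ hs]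
  suffices OuterMeasure.pi (fun i => (μ i).toOuterMeasure) ≤
    OuterMeasure.pi fun i => (ν i).toOuterMeasure from this s
  rw [OuterMeasure.le_pi]
  intro s _
  refine (OuterMeasure.pi_pi_le _ _).trans ?_
  exact Finset.prod_le_prod' fun i _ => h i _

theorem MeasureTheory.Measure.pi_const_smul {ι : Type*} [Fintype ι] {X : ι → Type*}
    [∀ i, MeasurableSpace (X i)] {μ : ∀ i, Measure (X i)} [∀ i, IsFiniteMeasure (μ i)]
    (c : ι → ℝ≥0∞) (hc : ∀ i, c i ≠ ∞) :
    Measure.pi (fun i => c i • μ i) = (∏ i, c i) • Measure.pi μ := by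
  have (i : ι) : IsFiniteMeasure (c i • μ i) := Measure.smul_finite _ (hc i)
  refine Measure.pi_eq fun s _ => ?_
  simp [Measure.pi_pi, Finset.prod_mul_distrib]

/-- One-dimensional factors multiply over independent coordinates; their exponents add up to an `ℓ₁`
norm, which is why sensitivity is measured in it. -/
theorem lintegral_pi_laplace_add_le {ι : Type*} [Fintype ι] {b : ℝ} (hb : 0 < b)
    [IsProbabilityMeasure (laplace b)] (s t : ι → ℝ) {F : (ι → ℝ) → ℝ≥0∞} (hF : Measurable F) :
    ∫⁻ v, F (s + v) ∂Measure.pi (fun _ : ι => laplace b) ≤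
      ENNReal.ofReal (Real.exp ((∑ i, |s i - t i|) / b)) *
        ∫⁻ v, F (t + v) ∂Measure.pi (fun _ : ι => laplace b) := by
  have key : ∀ r : ι → ℝ, ∫⁻ v, F (r + v) ∂Measure.pi (fun _ : ι => laplace b)
      = ∫⁻ y, F y ∂Measure.pi (fun i => (laplace b).map (fun x => r i + x)) := by
    intro r
    rw [← Measure.pi_map_pi (by fun_prop), lintegral_map hF (by fun_prop)]
    rfl
  have (r : ℝ) : IsProbabilityMeasure ((laplace b).map (fun x => r + x)) :=
    Measure.isProbabilityMeasure_map (by fun_prop)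
  rw [key s, key t, ← smul_eq_mul, ← lintegral_smul_measure]
  refine lintegral_mono' ?_ le_rfl
  refine (Measure.pi_mono_measure fun i => laplace_map_add_le hb (s i) (t i)).trans ?_
  rw [Measure.pi_const_smul _ (by simp),
    ← ENNReal.ofReal_prod_of_nonneg (fun _ _ => Real.exp_nonneg _),
    ← Real.exp_sum, Finset.sum_div]

/-! ### Independence -/

/-- Tonelli for the product law. It plays the role of conditioning on `U`: the first argument is
frozen while the second is averaged. -/
theorem ProbabilityTheory.IndepFun.lintegral_uncurry {Ω X Y : Type*} [MeasurableSpace Ω]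
    [MeasurableSpace X] [MeasurableSpace Y] {P : Measure Ω} [IsFiniteMeasure P]
    {U : Ω → X} {V : Ω → Y} (h : IndepFun U V P) (hU : Measurable U) (hV : Measurable V)
    {F : X → Y → ℝ≥0∞} (hF : Measurable (Function.uncurry F)) :
    ∫⁻ ω, F (U ω) (V ω) ∂P = ∫⁻ ω, ∫⁻ ω', F (U ω) (V ω') ∂P ∂P := by
  have h1 : ∫⁻ ω, F (U ω) (V ω) ∂P
      = ∫⁻ p, Function.uncurry F p ∂P.map (fun ω => (U ω, V ω)) := by
    rw [lintegral_map hF (hU.prodMk hV)]; rfl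
  rw [h1, h.map_prod_eq_prod_map_map hU.aemeasurable hV.aemeasurable,
    lintegral_prod _ hF.aemeasurable, lintegral_map hF.lintegral_prod_right' hU]
  refine lintegral_congr fun ω => ?_
  exact lintegral_map (hF.comp measurable_prodMk_left) hV

/-- The terms of an independent sequence before `k` are independent of the `k`-th one. -/
theorem ProbabilityTheory.iIndepFun.indepFun_past {Ω : Type*} [MeasurableSpace Ω] {P : Measure Ω}
    {X : Type*} [MeasurableSpace X] {f : ℕ → Ω → X} (h : iIndepFun f P)
    (hf : ∀ k, Measurable (f k)) (k : ℕ) :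
    IndepFun (fun ω (j : Fin k) => f j ω) (f k) P := by
  have h1 := h.indepFun_finset (Finset.range k) {k} (by simp) hf
  have h2 : Measurable fun v : ({k} : Finset ℕ) → X => v ⟨k, Finset.mem_singleton_self k⟩ :=
    measurable_pi_apply _
  exact h1.comp (φ := fun v (j : Fin k) => v ⟨j, Finset.mem_range.2 j.2⟩) (by fun_prop) h2

theorem DPOpt.measurable_toLp_comp {T : Type*} [MeasurableSpace T] {d : ℕ} {f : T → Fin d → ℝ}
    (hf : ∀ c, Measurable fun t => f t c) :
    Measurable fun t => (WithLp.toLp 2 (f t) : Vec d) :=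
  (WithLp.measurable_toLp 2 _).comp (measurable_pi_iff.2 hf)

namespace DPOpt.IsLaplaceNoise

variable {n d : ℕ} {Ω : Type*} [MeasurableSpace Ω] {P : Measure Ω} {σ : ℕ → ℝ}
  {ν : ℕ → Fin n → Ω → Vec d}

theorem measurable_profile (hν : IsLaplaceNoise P σ ν) (k : ℕ) :
    Measurable fun ω (i : Fin n) => ν k i ω :=
  measurable_pi_iff.2 fun i => hν.measurable k i

theorem indepFun_past (hν : IsLaplaceNoise P σ ν) (k : ℕ) :
    IndepFun (fun ω (j : Fin k) (i : Fin n) => ν j i ω) (fun ω (i : Fin n) => ν k i ω) P := by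
  have h1 := hν.indep.indepFun_finset (Finset.range k ×ˢ Finset.univ) ({k} ×ˢ Finset.univ)
    (Finset.disjoint_product.2 (Or.inl (by simp)))
    (fun p => (EuclideanSpace.proj (𝕜 := ℝ) p.2.2).continuous.measurable.comp
      (hν.measurable p.1 p.2.1))
  exact h1.comp
    (φ := fun v (j : Fin k) (i : Fin n) => WithLp.toLp 2 fun c : Fin d =>
      v ⟨((j : ℕ), i, c), by simp⟩)
    (ψ := fun v (i : Fin n) => WithLp.toLp 2 fun c : Fin d => v ⟨(k, i, c), by simp⟩)
    (measurable_pi_iff.2 fun j => measurable_pi_iff.2 fun i =>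
      measurable_toLp_comp fun c => measurable_pi_apply _)
    (measurable_pi_iff.2 fun i => measurable_toLp_comp fun c => measurable_pi_apply _)

theorem lintegral_add_le [IsProbabilityMeasure P] (hν : IsLaplaceNoise P σ ν) (k : ℕ)
    (hσ : 0 < σ k) (s t : Profile n d) {F : Profile n d → ℝ≥0∞} (hF : Measurable F) :
    ∫⁻ ω, F (fun i => s i + ν k i ω) ∂P ≤
      ENNReal.ofReal (Real.exp ((∑ i, l1Norm (s i - t i)) / σ k)) *
        ∫⁻ ω, F (fun i => t i + ν k i ω) ∂P := by
  -- Without any coordinate there is no noise law from which to read off that `laplace (σ k)` has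
  -- mass one; both sides then agree trivially.
  rcases isEmpty_or_nonempty (Fin n × Fin d) with hE | ⟨⟨i₀, c₀⟩⟩
  · have hst : s = t := by
      ext i c
      exact hE.elim (i, c)
    subst hst
    simp [l1Norm]
  have hm : ∀ p : Fin n × Fin d, Measurable fun ω => ν k p.1 ω p.2 := fun p =>
    (EuclideanSpace.proj (𝕜 := ℝ) p.2).continuous.measurable.comp (hν.measurable k p.1)
  have : IsProbabilityMeasure (laplace (σ k)) := by
    rw [← hν.law k i₀ c₀]
    exact Measure.isProbabilityMeasure_map (hm (i₀, c₀)).aemeasurable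
  have hlaw : P.map (fun ω (p : Fin n × Fin d) => ν k p.1 ω p.2)
      = Measure.pi fun _ => laplace (σ k) := by
    have h1 := hν.indep.precomp (g := fun p : Fin n × Fin d => (k, p))
      (fun p q h => (Prod.mk.inj h).2)
    rw [h1.map_fun_eq_pi_map fun p => (hm p).aemeasurable]
    simp_rw [hν.law]
  set F' : (Fin n × Fin d → ℝ) → ℝ≥0∞ := fun v => F fun i => WithLp.toLp 2 fun c => v (i, c)
  have hF' : Measurable F' := hF.comp
    (measurable_pi_iff.2 fun i => measurable_toLp_comp fun c => measurable_pi_apply _)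
  set w : Profile n d → Fin n × Fin d → ℝ := fun r p => r p.1 p.2
  have key : ∀ r : Profile n d, ∫⁻ ω, F (fun i => r i + ν k i ω) ∂P
      = ∫⁻ v, F' (w r + v) ∂Measure.pi fun _ => laplace (σ k) := by
    intro r
    rw [← hlaw, lintegral_map
      (f := fun v : Fin n × Fin d → ℝ => F' (w r + v))
      (hF'.comp (by fun_prop)) (measurable_pi_iff.2 hm)]
    rfl
  rw [key s, key t]
  have := lintegral_pi_laplace_add_le hσ (w s) (w t) hF'
  rw [Fintype.sum_prod_type] at this
  exact this

end DPOpt.IsLaplaceNoise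

/-! ### Measures compared on cylinders -/

/-- A generating algebra is dense for a finite measure. Density with respect to `μ + ν` yields one
approximating set that is good for both measures at once. -/
theorem MeasureTheory.Measure.le_of_forall_mem_isSetAlgebra {X : Type*} {m : MeasurableSpace X}
    {μ ν : Measure X} [IsFiniteMeasure μ] [IsFiniteMeasure ν] {𝒜 : Set (Set X)}
    (h𝒜 : IsSetAlgebra 𝒜) (hgen : m = MeasurableSpace.generateFrom 𝒜)
    (h : ∀ s ∈ 𝒜, μ s ≤ ν s) : μ ≤ ν := by
  rw [Measure.le_iff]
  intro s hs
  have hdense := Measure.MeasureDense.of_generateFrom_isSetAlgebra_finite (μ + ν) h𝒜 hgen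
  refine ENNReal.le_of_forall_pos_le_add fun ε hε _ => ?_
  obtain ⟨t, ht, hst⟩ := hdense.approx s hs (measure_ne_top _ _) (ε / 2) (by positivity)
  have hst' : (μ + ν) (symmDiff s t) ≤ ENNReal.ofReal (ε / 2) := hst.le
  rw [Measure.add_apply] at hst'
  have h1 : μ s ≤ μ t + μ (symmDiff s t) :=
    (measure_mono fun x hx => by
      by_cases hxt : x ∈ t
      · exact Or.inl hxt
      · exact Or.inr (Or.inl ⟨hx, hxt⟩)).trans (measure_union_le _ _)
  have h2 : ν t ≤ ν s + ν (symmDiff s t) :=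
    (measure_mono fun x hx => by
      by_cases hxt : x ∈ s
      · exact Or.inl hxt
      · exact Or.inr (Or.inr ⟨hx, hxt⟩)).trans (measure_union_le _ _)
  calc μ s ≤ ν t + μ (symmDiff s t) := h1.trans (by exact add_le_add_left (h t ht) _)
    _ ≤ ν s + ν (symmDiff s t) + μ (symmDiff s t) := by gcongr
    _ = ν s + (μ (symmDiff s t) + ν (symmDiff s t)) := by ring
    _ ≤ ν s + ENNReal.ofReal (ε / 2) := by gcongr
    _ ≤ ν s + ε := by
      gcongr
      rw [← ENNReal.ofReal_coe_nnreal]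
      exact ENNReal.ofReal_le_ofReal (by simp)

theorem MeasureTheory.Measure.le_of_forall_map_initial_le {X : Type*} [MeasurableSpace X]
    {μ ν : Measure (ℕ → X)} [IsFiniteMeasure μ] [IsFiniteMeasure ν]
    (h : ∀ (K : ℕ) (T : Set (Fin K → X)), MeasurableSet T →
      μ ((fun y (k : Fin K) => y k) ⁻¹' T) ≤ ν ((fun y (k : Fin K) => y k) ⁻¹' T)) :
    μ ≤ ν := by
  refine Measure.le_of_forall_mem_isSetAlgebra (𝒜 := measurableCylinders fun _ : ℕ => X)
    ⟨empty_mem_measurableCylinders _, fun s hs => compl_mem_measurableCylinders hs,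
      fun s t hs ht => union_mem_measurableCylinders hs ht⟩
    generateFrom_measurableCylinders.symm ?_
  intro s hs
  obtain ⟨I, T, hT, rfl⟩ := (mem_measurableCylinders s).1 hs
  obtain ⟨K, hK⟩ := I.exists_nat_subset_range
  -- A cylinder over a finite index set is also a cylinder over any initial segment containing that
  -- set.
  exact h K ((fun (v : Fin K → X) (i : I) => v ⟨i, Finset.mem_range.1 (hK i.2)⟩) ⁻¹' T)
    (measurableSet_preimage (by fun_prop) hT)

/-! ### Privacy from a bound on the state changes -/

namespace DPOpt.Alg

variable {n d : ℕ} (a : Alg n d)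

theorem measurable_step_comp {T : Type*} [MeasurableSpace T] (k : ℕ) {x y : T → Profile n d}
    {v : T → Fin n → ℕ → Vec d} (hx : Measurable x) (hy : Measurable y)
    (hv : ∀ i l, Measurable fun t => v t i l) :
    Measurable fun t => a.step k (x t) (y t) (v t) := by
  refine measurable_pi_iff.2 fun i => ?_
  unfold Alg.step
  have := hv i
  have hx' : ∀ i, Measurable fun t => x t i := fun i => measurable_pi_iff.1 hx i
  have hy' : ∀ i, Measurable fun t => y t i := fun i => measurable_pi_iff.1 hy i
  fun_prop

theorem measurable_state {D : GradData n d} (hD : ∀ k i l, Measurable fun h => D k h i l)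
    (k : ℕ) : Measurable (a.state D k) := by
  induction k with
  | zero => exact measurable_const
  | succ k ih =>
    have hinit : Measurable fun h : Fin (k + 1) → Profile n d => Fin.init h :=
      measurable_pi_iff.2 fun i => measurable_pi_apply _
    exact a.measurable_step_comp k (ih.comp hinit) (measurable_pi_apply _)
      fun i l => (hD k i l).comp hinit

theorem measurable_snoc {T X : Type*} [MeasurableSpace T] [MeasurableSpace X] {k : ℕ}
    {h : T → Fin k → X} {x : T → X} (hh : Measurable h) (hx : Measurable x) :
    Measurable fun t => (Fin.snoc (h t) (x t) : Fin (k + 1) → X) := by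
  refine measurable_pi_iff.2 fun i => ?_
  refine Fin.lastCases ?_ (fun j => ?_) i
  · simpa using hx
  · simpa using measurable_pi_iff.1 hh j

/-- The history before `k` involves only the noises before `k`, despite the feedback through the
data; this makes it independent of the `k`-th noise. -/
theorem exists_history_eq {D : GradData n d} (hD : ∀ k i l, Measurable fun h => D k h i l)
    (k : ℕ) : ∃ Φ : (Fin k → Profile n d) → Fin k → Profile n d, Measurable Φ ∧
      ∀ ν, a.history D ν k = Φ fun j => ν j := by
  induction k with
  | zero => exact ⟨id, measurable_id, fun ν => funext fun i => i.elim0⟩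
  | succ k ih =>
    obtain ⟨Φ, hΦ, h⟩ := ih
    have hinit : Measurable fun h : Fin (k + 1) → Profile n d => Fin.init h :=
      measurable_pi_iff.2 fun i => measurable_pi_apply _
    refine ⟨fun v => Fin.snoc (Φ (Fin.init v))
      (fun j => a.state D k (Φ (Fin.init v)) j + v (Fin.last k) j), ?_, fun ν => ?_⟩
    · refine measurable_snoc (hΦ.comp hinit) ?_
      exact ((a.measurable_state hD k).comp (hΦ.comp hinit)).add (measurable_pi_apply _)
    · simp only [Alg.history, h]
      rfl

theorem history_eq_output (D : GradData n d) (ν : ℕ → Profile n d) (K : ℕ) :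
    a.history D ν K = fun k : Fin K => a.output D ν k := by
  induction K with
  | zero => exact funext fun i => i.elim0
  | succ K ih =>
    funext i
    refine Fin.lastCases ?_ (fun j => ?_) i
    · simp only [Alg.history, Fin.snoc_last, Fin.val_last]
      rfl
    · simp [Alg.history, ih]

variable {Ω : Type*} [MeasurableSpace Ω] {P : Measure Ω} {σ : ℕ → ℝ}
  {ν : ℕ → Fin n → Ω → Vec d}

theorem measurable_history (hν : IsLaplaceNoise P σ ν) {D : GradData n d}
    (hD : ∀ k i l, Measurable fun h => D k h i l) (k : ℕ) :
    Measurable fun ω => a.history D (fun k j => ν k j ω) k := by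
  obtain ⟨Φ, hΦ, h⟩ := a.exists_history_eq hD k
  simp_rw [h]
  exact hΦ.comp (measurable_pi_iff.2 fun j => hν.measurable_profile j)

theorem measurable_output (hν : IsLaplaceNoise P σ ν) {D : GradData n d}
    (hD : ∀ k i l, Measurable fun h => D k h i l) :
    Measurable fun ω => a.output D (fun k j => ν k j ω) :=
  measurable_pi_iff.2 fun k => ((a.measurable_state hD k).comp
    (a.measurable_history hν hD k)).add (hν.measurable_profile k)

/-- The tower property: average over the noise of round `k` with the history frozen, then over the
history. -/
theorem lintegral_history_succ [IsProbabilityMeasure P] (hν : IsLaplaceNoise P σ ν)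
    {D : GradData n d} (hD : ∀ k i l, Measurable fun h => D k h i l) (k : ℕ)
    {F : (Fin (k + 1) → Profile n d) → ℝ≥0∞} (hF : Measurable F) :
    ∫⁻ ω, F (a.history D (fun k j => ν k j ω) (k + 1)) ∂P =
      ∫⁻ ω, (fun h => ∫⁻ ω', F (Fin.snoc h fun j => a.state D k h j + ν k j ω') ∂P)
        (a.history D (fun k j => ν k j ω) k) ∂P := by
  obtain ⟨Φ, hΦ, h⟩ := a.exists_history_eq hD k
  have hind : IndepFun (fun ω => a.history D (fun k j => ν k j ω) k)
      (fun ω j => ν k j ω) P := by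
    simp_rw [h]
    exact (hν.indepFun_past k).comp hΦ measurable_id
  refine hind.lintegral_uncurry (F := fun h v => F (Fin.snoc h fun j => a.state D k h j + v j))
    (a.measurable_history hν hD k) (hν.measurable_profile k) ?_
  exact hF.comp (measurable_snoc measurable_fst
    (((a.measurable_state hD k).comp measurable_fst).add measurable_snd))

/-- Adaptive composition. The last round is switched from `D` to `D'` at a common history, so `δ`
compares states only for equal exchanged values; the induction hypothesis then switches the history.
It is applied to the averaged function `G`, hence the statement for all `F` instead of events. -/
theorem lintegral_history_le [IsProbabilityMeasure P] (hν : IsLaplaceNoise P σ ν)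
    (hσ : ∀ k, 0 < σ k)
    {D D' : GradData n d} (hD : ∀ k i l, Measurable fun h => D k h i l)
    (hD' : ∀ k i l, Measurable fun h => D' k h i l) {δ : ℕ → ℝ}
    (hδ : ∀ k h, ∑ j, l1Norm (a.state D k h j - a.state D' k h j) ≤ δ k) (K : ℕ)
    {F : (Fin K → Profile n d) → ℝ≥0∞} (hF : Measurable F) :
    ∫⁻ ω, F (a.history D (fun k j => ν k j ω) K) ∂P ≤
      ENNReal.ofReal (Real.exp (∑ k ∈ Finset.range K, δ k / σ k)) *
        ∫⁻ ω, F (a.history D' (fun k j => ν k j ω) K) ∂P := by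
  induction K with
  | zero => simp [Alg.history]
  | succ K ih =>
    rw [a.lintegral_history_succ hν hD K hF, a.lintegral_history_succ hν hD' K hF,
      Finset.sum_range_succ, Real.exp_add, ENNReal.ofReal_mul (Real.exp_nonneg _)]
    set G : (Fin K → Profile n d) → ℝ≥0∞ := fun h =>
      ∫⁻ ω', F (Fin.snoc h fun j => a.state D' K h j + ν K j ω') ∂P
    have hG : Measurable G := by
      refine Measurable.lintegral_prod_right' (f := fun p : (Fin K → Profile n d) × Ω =>
        F (Fin.snoc p.1 fun j => a.state D' K p.1 j + ν K j p.2)) ?_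
      exact hF.comp (measurable_snoc measurable_fst
        (((a.measurable_state hD' K).comp measurable_fst).add
          ((hν.measurable_profile K).comp measurable_snd)))
    have hle : ∀ h, ∫⁻ ω', F (Fin.snoc h fun j => a.state D K h j + ν K j ω') ∂P ≤
        ENNReal.ofReal (Real.exp (δ K / σ K)) * G h := by
      intro h
      refine (hν.lintegral_add_le K (hσ K) (a.state D K h) (a.state D' K h)
        (F := fun v => F (Fin.snoc h v))
        (hF.comp (measurable_snoc measurable_const measurable_id))).trans ?_
      have := hδ K h
      have := (hσ K).le
      gcongr
    calc _ ≤ ∫⁻ ω, ENNReal.ofReal (Real.exp (δ K / σ K)) *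
          G (a.history D (fun k j => ν k j ω) K) ∂P := lintegral_mono fun ω => hle _
      _ = ENNReal.ofReal (Real.exp (δ K / σ K)) *
          ∫⁻ ω, G (a.history D (fun k j => ν k j ω) K) ∂P :=
        lintegral_const_mul' _ _ ENNReal.ofReal_ne_top
      _ ≤ ENNReal.ofReal (Real.exp (δ K / σ K)) *
          (ENNReal.ofReal (Real.exp (∑ k ∈ Finset.range K, δ k / σ k)) *
          ∫⁻ ω, G (a.history D' (fun k j => ν k j ω) K) ∂P) := by gcongr; exact ih hG
      _ = _ := by ring

theorem measure_output_le [IsProbabilityMeasure P] (hν : IsLaplaceNoise P σ ν) (hσ : ∀ k, 0 < σ k)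
    {D D' : GradData n d} (hD : ∀ k i l, Measurable fun h => D k h i l)
    (hD' : ∀ k i l, Measurable fun h => D' k h i l) {δ : ℕ → ℝ} {ε : ℝ}
    (hδ : ∀ k h, ∑ j, l1Norm (a.state D k h j - a.state D' k h j) ≤ δ k)
    (hε : ∀ K, ∑ k ∈ Finset.range K, δ k / σ k ≤ ε)
    {Y : Set (ℕ → Profile n d)} (hY : MeasurableSet Y) :
    P {ω | a.output D (fun k j => ν k j ω) ∈ Y} ≤
      ENNReal.ofReal (Real.exp ε) * P {ω | a.output D' (fun k j => ν k j ω) ∈ Y} := by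
  have hm := a.measurable_output hν hD
  have hm' := a.measurable_output hν hD'
  have hle : P.map (fun ω => a.output D (fun k j => ν k j ω)) ≤
      ENNReal.ofReal (Real.exp ε) • P.map (fun ω => a.output D' (fun k j => ν k j ω)) := by
    have := Measure.isProbabilityMeasure_map (μ := P) hm.aemeasurable
    have := Measure.isProbabilityMeasure_map (μ := P) hm'.aemeasurable
    have := Measure.smul_finite (P.map (fun ω => a.output D' (fun k j => ν k j ω)))
      (c := ENNReal.ofReal (Real.exp ε)) ENNReal.ofReal_ne_top
    refine Measure.le_of_forall_map_initial_le fun K T hT => ?_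
    have hres : Measurable fun (y : ℕ → Profile n d) (k : Fin K) => y k := by fun_prop
    have key : ∀ E : GradData n d, (∀ k i l, Measurable fun h => E k h i l) →
        P.map (fun ω => a.output E (fun k j => ν k j ω)) ((fun y (k : Fin K) => y k) ⁻¹' T)
        = ∫⁻ ω, T.indicator 1 (a.history E (fun k j => ν k j ω) K) ∂P := by
      intro E hE
      rw [Measure.map_apply (a.measurable_output hν hE) (hres hT), ← lintegral_indicator_one
        (a.measurable_output hν hE (hres hT))]
      simp_rw [a.history_eq_output]
      rfl
    rw [Measure.smul_apply, smul_eq_mul, key D hD, key D' hD']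
    refine (a.lintegral_history_le hν hσ hD hD' hδ K (measurable_one.indicator hT)).trans ?_
    gcongr
    exact hε K
  have := hle Y
  rwa [Measure.smul_apply, Measure.map_apply hm hY, Measure.map_apply hm' hY] at this

end DPOpt.Alg

/-! ### Recursive inequalities -/

/-- Once `e k ≤ ε / 2`, the excess of `W` over `ε / 2` contracts by `1 - c k ≤ exp (-c k)`, and the
product of these factors vanishes because the series diverges. -/
theorem tendsto_zero_of_le_one_sub_mul_add {W c e : ℕ → ℝ} (hW : ∀ k, 0 ≤ W k)
    (hc : ∀ᶠ k in atTop, 0 ≤ c k) (hc1 : ∀ᶠ k in atTop, c k ≤ 1) (hsum : ¬ Summable c)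
    (he : Tendsto e atTop (𝓝 0))
    (hrec : ∀ᶠ k in atTop, W (k + 1) ≤ (1 - c k) * W k + c k * e k) :
    Tendsto W atTop (𝓝 0) := by
  refine Metric.tendsto_atTop.2 fun ε hε => ?_
  have hee : ∀ᶠ k in atTop, e k ≤ ε / 2 :=
    (he.eventually_lt_const (by positivity : 0 < ε / 2)).mono fun _ h => h.le
  obtain ⟨N, hN⟩ := eventually_atTop.1 (hc.and (hc1.and (hee.and hrec)))
  set f : ℕ → ℝ := fun j => c (j + N)
  have hf0 : ∀ j, 0 ≤ f j := fun j => (hN (j + N) (by omega)).1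
  have hdiv : Tendsto (fun m => ∑ j ∈ Finset.range m, f j) atTop atTop :=
    (not_summable_iff_tendsto_nat_atTop_of_nonneg hf0).1 (by rwa [summable_nat_add_iff N])
  -- The absolute value keeps the right side nonnegative, so that `1 - c` may be replaced by `exp
  -- (-c)`.
  have hind : ∀ m, W (m + N) - ε / 2 ≤
      Real.exp (-∑ j ∈ Finset.range m, f j) * |W N - ε / 2| := by
    intro m
    induction m with
    | zero => simpa using le_abs_self (W N - ε / 2)
    | succ m ih =>
      obtain ⟨h0, h1, h2, h3⟩ := hN (m + N) (by omega)
      have h4 : W (m + 1 + N) - ε / 2 ≤ (1 - c (m + N)) * (W (m + N) - ε / 2) := by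
        rw [show m + 1 + N = m + N + 1 by ring]
        nlinarith [mul_le_mul_of_nonneg_left h2 h0]
      have h5 : 1 - c (m + N) ≤ Real.exp (-c (m + N)) := by
        have := Real.add_one_le_exp (-c (m + N))
        linarith
      calc _ ≤ _ := h4
        _ ≤ (1 - c (m + N)) * (Real.exp (-∑ j ∈ Finset.range m, f j) * |W N - ε / 2|) :=
          mul_le_mul_of_nonneg_left ih (by linarith)
        _ ≤ Real.exp (-c (m + N)) *
            (Real.exp (-∑ j ∈ Finset.range m, f j) * |W N - ε / 2|) := by gcongr
        _ = _ := by
          rw [Finset.sum_range_succ, neg_add, Real.exp_add]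
          ring
  have hlim : Tendsto (fun m => Real.exp (-∑ j ∈ Finset.range m, f j) * |W N - ε / 2|)
      atTop (𝓝 0) := by
    simpa using ((Real.tendsto_exp_neg_atTop_nhds_zero.comp hdiv).mul_const |W N - ε / 2|)
  obtain ⟨M, hM⟩ := eventually_atTop.1
    (hlim.eventually_lt_const (by positivity : 0 < ε / 2))
  refine ⟨M + N, fun k hk => ?_⟩
  obtain ⟨m, rfl⟩ : ∃ m, k = m + N := ⟨k - N, by omega⟩
  have h1 := hind m
  have h2 := hM m (by omega)
  rw [Real.dist_eq, sub_zero, abs_of_nonneg (hW _)]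
  linarith

/-- Comparison principle: every multiple of `r` from `M` on is eventually a supersolution of the
recursion, and a large enough multiple also dominates at the starting index. -/
theorem exists_eventually_le_mul_of_le_one_sub_mul_add {s q u r : ℕ → ℝ} {M : ℝ}
    (hq : ∀ k, q k ≤ 1) (hr : ∀ k, 0 < r k) (hs : ∀ k, s (k + 1) ≤ (1 - q k) * s k + u k)
    (hpos : ∀ᶠ k in atTop, 0 ≤ r (k + 1) - (1 - q k) * r k)
    (hu : ∀ᶠ k in atTop, u k ≤ M * (r (k + 1) - (1 - q k) * r k)) :
    ∃ K, ∀ᶠ k in atTop, s k ≤ K * r k := by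
  obtain ⟨N, hN⟩ := eventually_atTop.1 (hpos.and hu)
  refine ⟨max M (s N / r N), eventually_atTop.2 ⟨N, fun k hk => ?_⟩⟩
  induction k, hk using Nat.le_induction with
  | base => exact (div_le_iff₀ (hr N)).1 (le_max_right _ _)
  | succ k hk ih =>
    obtain ⟨h1, h2⟩ := hN k hk
    have h3 := mul_le_mul_of_nonneg_left ih (sub_nonneg.2 (hq k))
    have h4 := mul_le_mul_of_nonneg_right (le_max_left M (s N / r N)) h1
    have := hs k
    nlinarith

/-! ### Power asymptotics -/

theorem tendsto_natCast_add_const_atTop (c : ℝ) :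
    Tendsto (fun k : ℕ => (k : ℝ) + c) atTop atTop :=
  tendsto_atTop_add_const_right _ _ tendsto_natCast_atTop_atTop

theorem tendsto_natCast_add_rpow_zero (c : ℝ) {p : ℝ} (hp : p < 0) :
    Tendsto (fun k : ℕ => ((k : ℝ) + c) ^ p) atTop (𝓝 0) := by
  have := (tendsto_rpow_neg_atTop (y := -p) (by linarith)).comp
    (tendsto_natCast_add_const_atTop c)
  simpa [Function.comp_def] using this

/-- From `(1 + 1/t) ^ (-p) ≥ 1 - p log (1 + 1/t) ≥ 1 - p/t`: a power loses only a relative amount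
`p/t` per step. -/
theorem one_sub_div_mul_rpow_le {t p : ℝ} (ht : 0 < t) (hp : 0 ≤ p) :
    (1 - p / t) * t ^ (-p) ≤ (t + 1) ^ (-p) := by
  have h1 : (t + 1) ^ (-p) = (1 + 1 / t) ^ (-p) * t ^ (-p) := by
    rw [← Real.mul_rpow (by positivity) ht.le]
    congr 1
    field_simp
  rw [h1]
  gcongr
  rw [Real.rpow_def_of_pos (by positivity)]
  have h2 : Real.log (1 + 1 / t) ≤ 1 / t := by
    have := Real.log_le_sub_one_of_pos (show 0 < 1 + 1 / t by positivity)
    linarith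
  have h3 := mul_le_mul_of_nonneg_right h2 hp
  have h4 := Real.add_one_le_exp (Real.log (1 + 1 / t) * -p)
  have h5 : 1 / t * p = p / t := by ring
  linarith

theorem summable_natCast_add_rpow {c p : ℝ} (hc : 0 < c) :
    (Summable fun k : ℕ => ((k : ℝ) + c) ^ (-p)) ↔ 1 < p := by
  rw [← Real.summable_one_div_nat_add_rpow c p]
  refine summable_congr fun k => ?_
  have : 0 < (k : ℝ) + c := by positivity
  rw [abs_of_pos this, Real.rpow_neg this.le, one_div]

/-! ### Sensitivity -/

namespace DPOpt

variable {n d : ℕ}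

theorem l1Norm_zero : l1Norm (0 : Vec d) = 0 := by simp [l1Norm]

theorem l1Norm_sub_le (v w : Vec d) : l1Norm (v - w) ≤ l1Norm v + l1Norm w := by
  unfold l1Norm
  rw [← Finset.sum_add_distrib]
  exact Finset.sum_le_sum fun c _ => abs_sub _ _

theorem l1Norm_smul (r : ℝ) (v : Vec d) : l1Norm (r • v) = |r| * l1Norm v := by
  simp [l1Norm, abs_mul, Finset.mul_sum]

theorem l1Norm_sum_sub_sum_le {C : ℝ} (hC : 0 ≤ C) {v w : ℕ → Vec d} {l₀ : ℕ}
    (h₀ : l1Norm (v l₀ - w l₀) ≤ C) (h : ∀ l, l ≠ l₀ → v l = w l) (s : Finset ℕ) :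
    l1Norm (∑ l ∈ s, v l - ∑ l ∈ s, w l) ≤ C := by
  rw [← Finset.sum_sub_distrib]
  by_cases hs : l₀ ∈ s
  · rwa [Finset.sum_eq_single_of_mem l₀ hs fun l _ hl => by rw [h l hl, sub_self]]
  · rw [Finset.sum_eq_zero, l1Norm_zero]
    · exact hC
    · intro l hl
      rw [h l (by rintro rfl; exact hs hl), sub_self]

namespace Alg

variable (a : Alg n d)

/-- The solution of the recursion that bounds the sensitivity. -/
noncomputable def sensitivityBound (C : ℝ) : ℕ → ℝ
  | 0 => 0
  | k + 1 => (1 - a.mixStep k) * sensitivityBound C k + a.gradStep k * (1 / (a.batch k : ℝ) * C)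

variable {a}

theorem step_sub_step (k : ℕ) (x x' y : Profile n d) (v v' : Fin n → ℕ → Vec d) (i : Fin n) :
    a.step k x y v i - a.step k x' y v' i = (1 - a.mixStep k) • (x i - x' i)
      - a.gradStep k • ((1 / (a.batch k : ℝ)) • (∑ l ∈ Finset.range (a.batch k), v i l
        - ∑ l ∈ Finset.range (a.batch k), v' i l)) := by
  simp only [step]
  module

/-- The exchanged states are common, so the received average cancels in the difference: no other
agent is affected, and agent `i` keeps only the factor `1 - β_k` of its previous change. -/
theorem exists_state_sub_le {C : ℝ} (hC : 0 ≤ C) (hmix : ∀ k, a.mixStep k ≤ 1)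
    (hgrad : ∀ k, 0 ≤ a.gradStep k) {D D' : GradData n d} (h : Adjacent C D D') :
    ∃ i : Fin n, ∀ k h, (∀ j, j ≠ i → a.state D k h j = a.state D' k h j) ∧
      l1Norm (a.state D k h i - a.state D' k h i) ≤ a.sensitivityBound C k := by
  obtain ⟨i, hi⟩ := h
  refine ⟨i, fun k => ?_⟩
  induction k with
  | zero => simp [state, sensitivityBound, l1Norm_zero]
  | succ k ih =>
    intro h
    obtain ⟨ih1, ih2⟩ := ih (Fin.init h)
    obtain ⟨l₀, h1, h2⟩ := hi k (Fin.init h)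
    refine ⟨fun j hj => ?_, ?_⟩
    · have h3 : ∀ l, D k (Fin.init h) j l = D' k (Fin.init h) j l := fun l =>
        h2 j l fun hh => hj hh.1
      simp only [state, step, ih1 j hj, h3]
    · simp only [state, sensitivityBound]
      rw [step_sub_step]
      refine (l1Norm_sub_le _ _).trans ?_
      rw [l1Norm_smul, l1Norm_smul, l1Norm_smul, abs_of_nonneg (sub_nonneg.2 (hmix k)),
        abs_of_nonneg (hgrad k), abs_of_nonneg (by positivity : 0 ≤ 1 / (a.batch k : ℝ))]
      have h3 := l1Norm_sum_sub_sum_le hC h1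
        (fun l hl => h2 i l fun hh => hl hh.2) (Finset.range (a.batch k))
      have h4 := sub_nonneg.2 (hmix k)
      have h5 := hgrad k
      gcongr

theorem sensitivity_le {C : ℝ} (hC : 0 ≤ C) (hmix : ∀ k, a.mixStep k ≤ 1)
    (hgrad : ∀ k, 0 ≤ a.gradStep k) (k : ℕ) :
    a.sensitivity C k ≤ ENNReal.ofReal (a.sensitivityBound C k) := by
  unfold sensitivity
  refine iSup_le fun D => iSup_le fun D' => iSup_le fun hD => iSup_le fun h => iSup_le fun j => ?_
  obtain ⟨i, hi⟩ := exists_state_sub_le hC hmix hgrad hD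
  obtain ⟨h1, h2⟩ := hi k h
  by_cases hj : j = i
  · subst hj
    exact ENNReal.ofReal_le_ofReal h2
  · rw [h1 j hj, sub_self, l1Norm_zero]
    simp

theorem sensitivity_zero {C : ℝ} : a.sensitivity C 0 = 0 := by
  simp [sensitivity, state, l1Norm_zero]

/-- The sensitivity is a supremum over single agents; it controls the sum over all agents because
only one of them moves. Finiteness of the sensitivity makes `toReal` harmless. -/
theorem sum_l1Norm_state_sub_le {C : ℝ} (hC : 0 ≤ C) (hmix : ∀ k, a.mixStep k ≤ 1)
    (hgrad : ∀ k, 0 ≤ a.gradStep k) {D D' : GradData n d} (hD : Adjacent C D D') (k : ℕ)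
    (h : Fin k → Profile n d) :
    ∑ j, l1Norm (a.state D k h j - a.state D' k h j) ≤ (a.sensitivity C k).toReal := by
  obtain ⟨i, hi⟩ := exists_state_sub_le hC hmix hgrad hD
  rw [Finset.sum_eq_single i (fun j _ hj => by rw [(hi k h).1 j hj, sub_self, l1Norm_zero])
    (by simp)]
  refine (ENNReal.ofReal_le_iff_le_toReal
    (ne_top_of_le_ne_top ENNReal.ofReal_ne_top (sensitivity_le hC hmix hgrad k))).1 ?_
  unfold sensitivity
  exact le_iSup_of_le D (le_iSup_of_le D' (le_iSup_of_le hD (le_iSup_of_le h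
    (le_iSup_of_le i le_rfl))))

theorem isDifferentiallyPrivate_of_budget_lt_top {C : ℝ} (hC : 0 ≤ C)
    (hmix : ∀ k, a.mixStep k ≤ 1) (hgrad : ∀ k, 0 ≤ a.gradStep k)
    {Ω : Type*} [MeasurableSpace Ω] {P : Measure Ω} [IsProbabilityMeasure P] {σ : ℕ → ℝ}
    {ν : ℕ → Fin n → Ω → Vec d} (hν : IsLaplaceNoise P σ ν) (hσ : ∀ k, 0 < σ k)
    (hb : a.budget C σ < ⊤) :
    a.IsDifferentiallyPrivate P ν C (a.budget C σ).toReal := by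
  intro D D' hD hD' hadj Y hY
  refine a.measure_output_le hν hσ hD hD' (δ := fun k => (a.sensitivity C k).toReal)
    (sum_l1Norm_state_sub_le hC hmix hgrad hadj) (fun K => ?_) hY
  rcases K with _ | K
  · simp
  -- The output includes round `0` and the budget starts at round `1`; nothing is lost, since the
  -- initial states do not depend on the data.
  rw [Finset.sum_range_succ', sensitivity_zero]
  simp only [ENNReal.toReal_zero, zero_div, add_zero]
  have h1 : ∀ k, (a.sensitivity C (k + 1)).toReal / σ (k + 1)
      = (a.sensitivity C (k + 1) / ENNReal.ofReal (σ (k + 1))).toReal := fun k => by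
    rw [ENNReal.toReal_div, ENNReal.toReal_ofReal (hσ _).le]
  simp_rw [h1]
  rw [← ENNReal.toReal_sum]
  · exact ENNReal.toReal_mono hb.ne (ENNReal.sum_le_tsum _)
  · exact fun k _ => ENNReal.ne_top_of_tsum_ne_top hb.ne k

theorem budget_lt_top_of_summable {C : ℝ} (hC : 0 ≤ C) (hmix : ∀ k, a.mixStep k ≤ 1)
    (hgrad : ∀ k, 0 ≤ a.gradStep k) {σ : ℕ → ℝ} (hσ : ∀ k, 0 < σ k)
    (hs : Summable fun k => a.sensitivityBound C k / σ k) : a.budget C σ < ⊤ := by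
  have h1 := ((summable_nat_add_iff 1).2 hs).tsum_ofReal_lt_top
  refine lt_of_le_of_lt ?_ h1
  unfold budget
  refine ENNReal.tsum_le_tsum fun k => ?_
  rw [ENNReal.ofReal_div_of_pos (hσ _)]
  exact ENNReal.div_le_div_right (sensitivity_le hC hmix hgrad _) _

theorem sensitivityBound_nonneg {C : ℝ} (hC : 0 ≤ C) (hmix : ∀ k, a.mixStep k ≤ 1)
    (hgrad : ∀ k, 0 ≤ a.gradStep k) (k : ℕ) : 0 ≤ a.sensitivityBound C k := by
  induction k with
  | zero => exact le_rfl
  | succ k ih =>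
    have := sub_nonneg.2 (hmix k)
    have := hgrad k
    simp only [sensitivityBound]
    positivity

/-- The natural size of the bound is source over contraction, `α_k / (γ_k β_k)`, that is, the power
`-p`. The drift of this power is of relative size `p/t`, negligible against `β_k` as `β < 1`. -/
theorem summable_sensitivityBound_div {C : ℝ} (hC : 0 ≤ C) (hmix1 : ∀ k, a.mixStep k ≤ 1)
    {α β γ η a₁ a₂ a₃ b : ℝ} (ha₁ : 0 < a₁) (ha₂ : 0 < a₂) (ha₃ : 0 < a₃) (hb : 0 < b)
    (hsum : 1 < α + γ - β + η) (hβα : β < α) (hβ1 : β < 1) (hγ : 0 ≤ γ)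
    (hgrad : ∀ k : ℕ, a.gradStep k = a₁ / ((k : ℝ) + a₂) ^ α)
    (hmix : ∀ k : ℕ, a.mixStep k = a₁ / ((k : ℝ) + a₂) ^ β)
    (hbatch : ∀ k : ℕ, a₃ * ((k : ℝ) + a₂) ^ γ ≤ a.batch k)
    {σ : ℕ → ℝ} (hσ : ∀ k : ℕ, σ k = b * ((k : ℝ) + a₂) ^ η) :
    Summable fun k => a.sensitivityBound C k / σ k := by
  have ht : ∀ k : ℕ, 0 < (k : ℝ) + a₂ := fun k => by positivity
  set p := α + γ - β with hp
  have hp0 : 0 < p := by linarith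
  -- Half of the contraction `a₁ t ^ (-β)` pays for the drift `p / t`; the other half remains.
  have hgap : ∀ᶠ k : ℕ in atTop, a₁ / 2 * ((k : ℝ) + a₂) ^ (-β - p) ≤
      (((k + 1 : ℕ) : ℝ) + a₂) ^ (-p) - (1 - a.mixStep k) * ((k : ℝ) + a₂) ^ (-p) := by
    have hlim := (tendsto_natCast_add_rpow_zero a₂ (p := β - 1) (by linarith)).const_mul p
    rw [mul_zero] at hlim
    filter_upwards [hlim.eventually_lt_const (by positivity : 0 < a₁ / 2)] with k hk
    have h1 := one_sub_div_mul_rpow_le (ht k) hp0.le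
    have h2 : (((k + 1 : ℕ) : ℝ) + a₂) = (k : ℝ) + a₂ + 1 := by push_cast; ring
    rw [h2, hmix]
    have h3 : p / ((k : ℝ) + a₂) ≤ a₁ / 2 * ((k : ℝ) + a₂) ^ (-β) := by
      have h4 : ((k : ℝ) + a₂) ^ (β - 1) * ((k : ℝ) + a₂) ^ (-β) = ((k : ℝ) + a₂)⁻¹ := by
        rw [← Real.rpow_add (ht k), ← Real.rpow_neg_one]
        congr 1; ring
      rw [div_eq_mul_inv, ← h4, ← mul_assoc]
      have := (Real.rpow_pos_of_pos (ht k) (-β)).le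
      gcongr
    have h5 : ((k : ℝ) + a₂) ^ (-β - p) = ((k : ℝ) + a₂) ^ (-β) * ((k : ℝ) + a₂) ^ (-p) := by
      rw [← Real.rpow_add (ht k)]; congr 1
    have h6 : a₁ / ((k : ℝ) + a₂) ^ β = a₁ * ((k : ℝ) + a₂) ^ (-β) := by
      rw [Real.rpow_neg (ht k).le]; rfl
    rw [h5, h6]
    have h7 := Real.rpow_pos_of_pos (ht k) (-p)
    nlinarith [mul_le_mul_of_nonneg_right h3 h7.le]
  have hgrad0 : ∀ k, 0 ≤ a.gradStep k := fun k => by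
    rw [hgrad]; have := ht k; positivity
  -- `M = 2 * C / a₃` makes `M` times the gap `a₁ / 2 * t ^ (-β - p)` equal to the source with `γ_k`
  -- replaced by its lower bound.
  obtain ⟨K, hK⟩ := exists_eventually_le_mul_of_le_one_sub_mul_add
    (s := a.sensitivityBound C) (q := a.mixStep) (M := 2 * C / a₃)
    (u := fun k => a.gradStep k * (1 / (a.batch k : ℝ) * C))
    (r := fun k : ℕ => ((k : ℝ) + a₂) ^ (-p)) hmix1 (fun k => Real.rpow_pos_of_pos (ht k) _)
    (fun k => le_rfl)
    (hgap.mono fun k hk => le_trans (by have := ht k; positivity) hk)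
    (hgap.mono fun k hk => by
      refine le_trans ?_ (mul_le_mul_of_nonneg_left hk (by positivity))
      have hpos : 0 < a₃ * ((k : ℝ) + a₂) ^ γ := by have := ht k; positivity
      calc a.gradStep k * (1 / (a.batch k : ℝ) * C)
          ≤ a.gradStep k * (1 / (a₃ * ((k : ℝ) + a₂) ^ γ) * C) := by
            have := hgrad0 k
            have := hbatch k
            gcongr
        _ = 2 * C / a₃ * (a₁ / 2 * ((k : ℝ) + a₂) ^ (-β - p)) := by
          rw [hgrad, show -β - p = -α + -γ by rw [hp]; ring, Real.rpow_add (ht k),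
            Real.rpow_neg (ht k).le, Real.rpow_neg (ht k).le]
          field_simp)
  have hsummable : Summable fun k : ℕ => K / b * ((k : ℝ) + a₂) ^ (-(p + η)) :=
    ((summable_natCast_add_rpow ha₂).2 (by linarith)).mul_left _
  refine hsummable.of_norm_bounded_eventually_nat ?_
  filter_upwards [hK] with k hk
  have h1 := sensitivityBound_nonneg hC hmix1 hgrad0 k
  have h2 : 0 < σ k := by rw [hσ]; have := ht k; positivity
  rw [Real.norm_of_nonneg (by positivity), div_le_iff₀ h2, hσ]
  have h3 : K / b * ((k : ℝ) + a₂) ^ (-(p + η)) * (b * ((k : ℝ) + a₂) ^ η)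
      = K * ((k : ℝ) + a₂) ^ (-p) := by
    rw [show -p = -(p + η) + η by ring, Real.rpow_add (ht k)]
    field_simp
  rw [h3]
  exact hk

end Alg

end DPOpt

/-! ### The Dirichlet form of a communication matrix -/

section Network

variable {n : ℕ} {E : Type*} [NormedAddCommGroup E]

theorem norm_sum_smul_sq_le [NormedSpace ℝ E] {ι : Type*} (s : Finset ι) {w : ι → ℝ}
    (hw : ∀ i ∈ s, 0 ≤ w i) (hw1 : ∑ i ∈ s, w i = 1) (v : ι → E) :
    ‖∑ i ∈ s, w i • v i‖ ^ 2 ≤ ∑ i ∈ s, w i * ‖v i‖ ^ 2 := by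
  refine le_trans ?_ (Real.pow_arith_mean_le_arith_mean_pow s w (fun i => ‖v i‖) hw hw1
    (fun i _ => norm_nonneg _) 2)
  gcongr
  refine (norm_sum_le _ _).trans (Finset.sum_le_sum fun i hi => ?_)
  rw [norm_smul, Real.norm_of_nonneg (hw i hi)]

/-- The Dirichlet form `∑ a_{ij} ‖z_i - z_j‖²`. -/
def dirichletForm (A : Matrix (Fin n) (Fin n) ℝ) (z : Fin n → E) : ℝ :=
  ∑ i, ∑ j, A i j * ‖z i - z j‖ ^ 2

/-- The disagreement `z_i - ∑_j a_{ij} z_j` of agent `i` with its neighbours. -/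
def disagreement [NormedSpace ℝ E] (A : Matrix (Fin n) (Fin n) ℝ) (z : Fin n → E) (i : Fin n) : E :=
  z i - ∑ j, A i j • z j

variable {A : Matrix (Fin n) (Fin n) ℝ}

theorem dirichletForm_nonneg (hA : A ∈ doublyStochastic ℝ (Fin n)) (z : Fin n → E) :
    0 ≤ dirichletForm A z := by
  have h := (mem_doublyStochastic_iff_sum.1 hA).1
  exact Finset.sum_nonneg fun i _ => Finset.sum_nonneg fun j _ =>
    mul_nonneg (h i j) (sq_nonneg _)

theorem disagreement_eq_sum [NormedSpace ℝ E]
    (hA : A ∈ doublyStochastic ℝ (Fin n)) (z : Fin n → E) (i : Fin n) :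
    disagreement A z i = ∑ j, A i j • (z i - z j) := by
  have h := (mem_doublyStochastic_iff_sum.1 hA).2.1 i
  simp_rw [smul_sub, Finset.sum_sub_distrib, ← Finset.sum_smul, h, one_smul]
  rfl

/-- Expand the squares. The `‖z_i‖²` terms cancel by row sums and the `‖z_j‖²` terms by column sums,
so no symmetry of `A` is needed. -/
theorem sum_inner_disagreement [InnerProductSpace ℝ E]
    (hA : A ∈ doublyStochastic ℝ (Fin n)) (z : Fin n → E) :
    2 * ∑ i, inner ℝ (z i) (disagreement A z i) = dirichletForm A z := by
  obtain ⟨-, hrow, hcol⟩ := mem_doublyStochastic_iff_sum.1 hA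
  have h1 : ∀ i j, A i j * ‖z i - z j‖ ^ 2
      = 2 * (A i j * inner ℝ (z i) (z i - z j)) - A i j * ‖z i‖ ^ 2 + A i j * ‖z j‖ ^ 2 := by
    intro i j
    rw [norm_sub_sq_real, inner_sub_right, real_inner_self_eq_norm_sq]
    ring
  have h2 : ∑ i, ∑ j, A i j * ‖z i‖ ^ 2 = ∑ i, ‖z i‖ ^ 2 := by
    simp_rw [← Finset.sum_mul, hrow, one_mul]
  have h3 : ∑ i, ∑ j, A i j * ‖z j‖ ^ 2 = ∑ i, ‖z i‖ ^ 2 := by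
    rw [Finset.sum_comm]
    simp_rw [← Finset.sum_mul, hcol, one_mul]
  unfold dirichletForm
  simp_rw [h1, Finset.sum_add_distrib, Finset.sum_sub_distrib, h2, h3, disagreement_eq_sum hA,
    inner_sum, real_inner_smul_right, Finset.mul_sum]
  ring

theorem sum_norm_disagreement_sq_le [NormedSpace ℝ E]
    (hA : A ∈ doublyStochastic ℝ (Fin n)) (z : Fin n → E) :
    ∑ i, ‖disagreement A z i‖ ^ 2 ≤ dirichletForm A z := by
  obtain ⟨hpos, hrow, -⟩ := mem_doublyStochastic_iff_sum.1 hA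
  refine Finset.sum_le_sum fun i _ => ?_
  rw [disagreement_eq_sum hA]
  exact norm_sum_smul_sq_le _ (fun j _ => hpos i j) (hrow i) _

/-- Telescope along a shortest path: the Dirichlet form contains each edge with weight at least `c`.
-/
theorem norm_sub_le_dist_mul_sqrt {G : SimpleGraph (Fin n)}
    (hA : A ∈ doublyStochastic ℝ (Fin n)) (hG : G.Connected) {c : ℝ} (hc : 0 < c)
    (hcA : ∀ i j, G.Adj i j → c ≤ A i j) (z : Fin n → E) (i j : Fin n) :
    ‖z i - z j‖ ≤ G.dist i j * Real.sqrt (dirichletForm A z / c) := by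
  obtain ⟨p, hp⟩ := hG.exists_walk_length_eq_dist i j
  rw [← hp]
  -- The induction runs over arbitrary walks; minimality of the length would not pass to it.
  clear hp
  have hpos := (mem_doublyStochastic_iff_sum.1 hA).1
  have hterm : ∀ i j, 0 ≤ A i j * ‖z i - z j‖ ^ 2 := fun i j =>
    mul_nonneg (hpos i j) (sq_nonneg _)
  induction p with
  | nil => simp
  | @cons u v w h p ih =>
    have h1 : ‖z u - z v‖ ≤ Real.sqrt (dirichletForm A z / c) := by
      refine Real.le_sqrt_of_sq_le ((le_div_iff₀ hc).2 ?_)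
      calc ‖z u - z v‖ ^ 2 * c ≤ A u v * ‖z u - z v‖ ^ 2 := by
            rw [mul_comm]
            exact mul_le_mul_of_nonneg_right (hcA u v h) (sq_nonneg _)
        _ ≤ ∑ j, A u j * ‖z u - z j‖ ^ 2 :=
          Finset.single_le_sum (fun j _ => hterm u j) (Finset.mem_univ v)
        _ ≤ dirichletForm A z :=
          Finset.single_le_sum (f := fun i => ∑ j, A i j * ‖z i - z j‖ ^ 2)
            (fun i _ => Finset.sum_nonneg fun j _ => hterm i j) (Finset.mem_univ u)
    have h2 := norm_sub_le_norm_sub_add_norm_sub (z u) (z v) (z w)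
    rw [SimpleGraph.Walk.length_cons]
    push_cast
    linarith

/-- Vectors that sum to zero only see the disagreement of a profile. -/
theorem exists_abs_sum_inner_le_mul_sqrt [InnerProductSpace ℝ E] {G : SimpleGraph (Fin n)}
    (hA : IsCommunicationMatrix G A) {v : Fin n → E} (hv : ∑ i, v i = 0) :
    ∃ K : ℝ, 0 ≤ K ∧ ∀ z : Fin n → E,
      |∑ i, inner ℝ (z i) (v i)| ≤ K * Real.sqrt (dirichletForm A z) := by
  obtain ⟨c, hc, hcA⟩ := hA.lower
  obtain ⟨i₀⟩ := hA.connected.nonempty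
  refine ⟨(∑ i, (G.dist i i₀ : ℝ) * ‖v i‖) / Real.sqrt c, by positivity, fun z => ?_⟩
  have h1 : ∑ i, inner ℝ (z i) (v i) = ∑ i, inner ℝ (z i - z i₀) (v i) := by
    simp_rw [inner_sub_left, Finset.sum_sub_distrib, ← inner_sum, hv, inner_zero_right, sub_zero]
  rw [h1, div_mul_eq_mul_div, ← mul_div_assoc', ← Real.sqrt_div' _ hc.le, Finset.sum_mul]
  refine (Finset.abs_sum_le_sum_abs _ _).trans (Finset.sum_le_sum fun i _ => ?_)
  have h2 := norm_sub_le_dist_mul_sqrt hA.doublyStochastic hA.connected hc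
    (fun i j h => (hcA i j (Or.inr h)).le) z i i₀
  calc |inner ℝ (z i - z i₀) (v i)| ≤ ‖z i - z i₀‖ * ‖v i‖ := abs_real_inner_le_norm _ _
    _ ≤ (G.dist i i₀ * Real.sqrt (dirichletForm A z / c)) * ‖v i‖ := by gcongr
    _ = _ := by ring

/-- One noiseless step contracts the squared distance to a common zero of `∑ g_i`. -/
theorem exists_sum_norm_step_sq_le [InnerProductSpace ℝ E] {G : SimpleGraph (Fin n)}
    (hA : IsCommunicationMatrix G A)
    {g : Fin n → E → E} {L : Fin n → ℝ} {μ : ℝ}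
    (hL : ∀ i x y, ‖g i x - g i y‖ ≤ L i * ‖x - y‖)
    (hg : ∀ i x y, μ * ‖x - y‖ ^ 2 ≤ inner ℝ (g i x - g i y) (x - y))
    {p : E} (hp : ∑ i, g i p = 0) :
    ∃ B : ℝ, 0 ≤ B ∧ ∀ s q : ℝ, 0 ≤ s → 0 < q → q ≤ 1 / 4 → ∀ x : Fin n → E,
      ∑ i, ‖(1 - q) • x i + q • ∑ j, A i j • x j - s • g i (x i) - p‖ ^ 2 ≤
        (1 - 2 * μ * s + B * s ^ 2) * ∑ i, ‖x i - p‖ ^ 2 + B * (s ^ 2 / q + s ^ 2) := by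
  obtain ⟨K, hK0, hK⟩ := exists_abs_sum_inner_le_mul_sqrt hA hp
  have hLam : ∀ i, L i ^ 2 ≤ ∑ i, L i ^ 2 := fun i =>
    Finset.single_le_sum (f := fun i => L i ^ 2) (fun i _ => sq_nonneg _) (Finset.mem_univ i)
  set Λ : ℝ := ∑ i, L i ^ 2
  have hΛ0 : 0 ≤ Λ := Finset.sum_nonneg fun i _ => sq_nonneg _
  set R : ℝ := ∑ i, ‖g i p‖ ^ 2
  have hR0 : 0 ≤ R := Finset.sum_nonneg fun i _ => sq_nonneg _
  -- `4 * Λ` and `4 * R` come from the squared gradient step, `2 * K ^ 2` from Young's inequality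
  -- for the cross term.
  refine ⟨4 * Λ + 4 * R + 2 * K ^ 2, by positivity, fun s q hs hq hq4 x => ?_⟩
  set z : Fin n → E := fun i => x i - p with hz
  have hds := hA.doublyStochastic
  have hrow := (mem_doublyStochastic_iff_sum.1 hds).2.1
  set D := dirichletForm A z
  have hD0 : 0 ≤ D := dirichletForm_nonneg hds z
  set N : ℝ := ∑ i, ‖z i‖ ^ 2
  have hN0 : 0 ≤ N := Finset.sum_nonneg fun i _ => sq_nonneg _
  set w := disagreement A z
  have heq : ∀ i, (1 - q) • x i + q • ∑ j, A i j • x j - s • g i (x i) - p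
      = z i - q • w i - s • g i (x i) := by
    intro i
    have h1 : ∑ j, A i j • z j = ∑ j, A i j • x j - p := by
      simp_rw [hz, smul_sub, Finset.sum_sub_distrib, ← Finset.sum_smul, hrow, one_smul]
    have h2 : w i = (x i - p) - (∑ j, A i j • x j - p) := by rw [← h1]; rfl
    rw [h2, hz]
    module
  have hpt : ∀ i, ‖z i - q • w i - s • g i (x i)‖ ^ 2 ≤ ‖z i‖ ^ 2
      - 2 * q * inner ℝ (z i) (w i) + 2 * q ^ 2 * ‖w i‖ ^ 2 - 2 * s * (μ * ‖z i‖ ^ 2)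
      - 2 * s * inner ℝ (z i) (g i p) + 2 * s ^ 2 * (2 * Λ * ‖z i‖ ^ 2 + 2 * ‖g i p‖ ^ 2) := by
    intro i
    have e1 : ‖z i - q • w i - s • g i (x i)‖ ^ 2 = ‖z i‖ ^ 2 - 2 * q * inner ℝ (z i) (w i)
        - 2 * s * inner ℝ (z i) (g i (x i)) + ‖q • w i + s • g i (x i)‖ ^ 2 := by
      rw [sub_sub, norm_sub_sq_real, inner_add_right, real_inner_smul_right,
        real_inner_smul_right]
      ring
    have e2 : ‖q • w i + s • g i (x i)‖ ^ 2 ≤ 2 * q ^ 2 * ‖w i‖ ^ 2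
        + 2 * s ^ 2 * ‖g i (x i)‖ ^ 2 := by
      have h1 := parallelogram_law_with_norm ℝ (q • w i) (s • g i (x i))
      have h2 := sq_nonneg ‖q • w i - s • g i (x i)‖
      rw [norm_smul q, norm_smul s] at h1
      have h3 : ‖q‖ ^ 2 = q ^ 2 := by simp
      have h4 : ‖s‖ ^ 2 = s ^ 2 := by simp
      rw [← h3, ← h4]
      linarith
    have e3 : μ * ‖z i‖ ^ 2 + inner ℝ (z i) (g i p) ≤ inner ℝ (z i) (g i (x i)) := by
      have h1 := hg i (x i) p
      rw [real_inner_comm, inner_sub_right] at h1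
      linarith
    have e4 : ‖g i (x i)‖ ^ 2 ≤ 2 * Λ * ‖z i‖ ^ 2 + 2 * ‖g i p‖ ^ 2 := by
      have h1 : ‖g i (x i)‖ ≤ L i * ‖z i‖ + ‖g i p‖ := by
        have h2 := norm_add_le (g i (x i) - g i p) (g i p)
        rw [sub_add_cancel] at h2
        linarith [hL i (x i) p]
      have h3 : ‖g i (x i)‖ ^ 2 ≤ (L i * ‖z i‖ + ‖g i p‖) ^ 2 := by gcongr
      have h4 : L i ^ 2 * ‖z i‖ ^ 2 ≤ Λ * ‖z i‖ ^ 2 := by gcongr; exact hLam i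
      nlinarith [sq_nonneg (L i * ‖z i‖ - ‖g i p‖)]
    have e5 := mul_le_mul_of_nonneg_left e3 (by positivity : 0 ≤ 2 * s)
    have e6 := mul_le_mul_of_nonneg_left e4 (by positivity : 0 ≤ 2 * s ^ 2)
    rw [e1]
    linarith
  have hsum : ∑ i, ‖z i - q • w i - s • g i (x i)‖ ^ 2 ≤ N - q * D
      + 2 * q ^ 2 * ∑ i, ‖w i‖ ^ 2 - 2 * s * (μ * N)
      - 2 * s * ∑ i, inner ℝ (z i) (g i p) + 2 * s ^ 2 * (2 * Λ * N + 2 * R) := by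
    refine (Finset.sum_le_sum fun i _ => hpt i).trans (le_of_eq ?_)
    have h0 : 2 * ∑ i, inner ℝ (z i) (w i) = D := sum_inner_disagreement hds z
    have h1 : q * D = 2 * q * ∑ i, inner ℝ (z i) (w i) := by rw [← h0]; ring
    rw [h1]
    simp only [N, R, Finset.sum_add_distrib, Finset.sum_sub_distrib, ← Finset.mul_sum]
  have hwD := sum_norm_disagreement_sq_le hds z
  have hcross : -∑ i, inner ℝ (z i) (g i p) ≤ K * Real.sqrt D :=
    (neg_le_abs _).trans (hK z)
  -- The cross term is charged to half of the dissipation `q * D`. The other half absorbs the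
  -- second-order mixing term `2 * q ^ 2 * D`, which is where `q ≤ 1 / 4` enters.
  have hyoung : 2 * s * (K * Real.sqrt D) ≤ q * D / 2 + 2 * K ^ 2 * (s ^ 2 / q) := by
    have h1 : 0 ≤ (q * Real.sqrt D - 2 * s * K) ^ 2 / (2 * q) := by positivity
    have h2 : (q * Real.sqrt D - 2 * s * K) ^ 2 / (2 * q)
        = q * Real.sqrt D ^ 2 / 2 - 2 * s * (K * Real.sqrt D) + 2 * K ^ 2 * (s ^ 2 / q) := by
      field_simp
      ring
    rw [Real.sq_sqrt hD0] at h2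
    linarith
  simp_rw [heq]
  have h1 := mul_le_mul_of_nonneg_left hwD (by positivity : 0 ≤ 2 * q ^ 2)
  have h2 : 2 * q ^ 2 * D ≤ q * D / 2 := by
    have := mul_le_mul_of_nonneg_right hq4 (mul_nonneg hq.le hD0)
    nlinarith
  have h3 := mul_le_mul_of_nonneg_left hcross (by positivity : 0 ≤ 2 * s)
  have h4 : 0 ≤ s ^ 2 / q := by positivity
  have h5 : 0 ≤ s ^ 2 * N := by positivity
  have h6 : 0 ≤ s ^ 2 * K ^ 2 := by positivity
  have h7 : 0 ≤ s ^ 2 / q * Λ := by positivity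
  have h8 : 0 ≤ s ^ 2 / q * R := by positivity
  have h9 : 0 ≤ s ^ 2 * Λ := by positivity
  have h10 : 0 ≤ s ^ 2 * R * N := by positivity
  have h11 : 0 ≤ s ^ 2 * K ^ 2 * N := by positivity
  nlinarith

end Network

/-! ### Minimizers of strongly convex functions -/

/-- Banach's fixed point theorem for `x - t • H x`. The squared Lipschitz factor is at most `1 - 2 t
m + t² Λ²`, minimal at `t = m / Λ ^ 2`. -/
theorem exists_zero_of_lipschitz_of_strongly_monotone {E : Type*} [NormedAddCommGroup E]
    [InnerProductSpace ℝ E] [CompleteSpace E] {H : E → E} {Λ m : ℝ} (hΛ : 0 < Λ) (hm : 0 < m)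
    (hL : ∀ x y, ‖H x - H y‖ ≤ Λ * ‖x - y‖)
    (hH : ∀ x y, m * ‖x - y‖ ^ 2 ≤ inner ℝ (H x - H y) (x - y)) : ∃ x, H x = 0 := by
  set t := m / Λ ^ 2 with ht
  have ht0 : 0 < t := by positivity
  set r := 1 - m ^ 2 / Λ ^ 2 with hr
  have hr1 : r < 1 := by
    have : 0 < m ^ 2 / Λ ^ 2 := by positivity
    linarith
  have hcontr : ContractingWith (Real.sqrt r).toNNReal fun x => x - t • H x := by
    refine ⟨?_, LipschitzWith.of_dist_le_mul fun x y => ?_⟩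
    · rw [Real.toNNReal_lt_one, Real.sqrt_lt' one_pos]
      simpa using hr1
    · rw [Real.coe_toNNReal _ (Real.sqrt_nonneg _), dist_eq_norm, dist_eq_norm]
      have h1 : ‖x - t • H x - (y - t • H y)‖ ^ 2 ≤ r * ‖x - y‖ ^ 2 := by
        have e1 : x - t • H x - (y - t • H y) = (x - y) - t • (H x - H y) := by module
        have e2 : ‖H x - H y‖ ^ 2 ≤ (Λ * ‖x - y‖) ^ 2 := by gcongr; exact hL x y
        rw [e1, norm_sub_sq_real, real_inner_smul_right, norm_smul, mul_pow,
          Real.norm_of_nonneg ht0.le, real_inner_comm]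
        have e3 := mul_le_mul_of_nonneg_left (hH x y) (by positivity : 0 ≤ 2 * t)
        have e4 := mul_le_mul_of_nonneg_left e2 (by positivity : 0 ≤ t ^ 2)
        have e5 : r * ‖x - y‖ ^ 2 = ‖x - y‖ ^ 2 - 2 * t * (m * ‖x - y‖ ^ 2)
            + t ^ 2 * (Λ * ‖x - y‖) ^ 2 := by
          rw [hr, ht]
          field_simp
          ring
        rw [e5]
        linarith
      have h2 := Real.le_sqrt_of_sq_le h1
      rwa [Real.sqrt_mul' _ (sq_nonneg _), Real.sqrt_sq (norm_nonneg _)] at h2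
  refine ⟨hcontr.fixedPoint, ?_⟩
  have h : hcontr.fixedPoint - t • H hcontr.fixedPoint = hcontr.fixedPoint :=
    hcontr.fixedPoint_isFixedPt
  rw [sub_eq_self] at h
  exact (smul_eq_zero.1 h).resolve_left ht0.ne'

namespace DPOpt.IsSmoothStronglyConvex

variable {d : ℕ} {F : Vec d → ℝ} {L μ : ℝ}

/-- Along the segment, `F` minus its linearization at `x` has nonnegative derivative by monotonicity
of the gradient. -/
theorem add_inner_gradient_le (hF : IsSmoothStronglyConvex F L μ) (hμ : 0 ≤ μ) (x y : Vec d) :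
    F x + inner ℝ (gradient F x) (y - x) ≤ F y := by
  set v := y - x with hv
  set φ : ℝ → ℝ := fun t => F (x + t • v) - t * inner ℝ (gradient F x) v
  have hderiv : ∀ t, HasDerivAt φ
      (inner ℝ (gradient F (x + t • v)) v - inner ℝ (gradient F x) v) t := by
    intro t
    have h1 := (hF.differentiable (x + t • v)).hasGradientAt.hasFDerivAt
    have h2 : HasDerivAt (fun t : ℝ => x + t • v) v t := by
      simpa using ((hasDerivAt_id t).smul_const v).const_add x
    have h3 := h1.comp_hasDerivAt t h2
    have h4 := h3.sub ((hasDerivAt_id t).mul_const (inner ℝ (gradient F x) v))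
    rw [InnerProductSpace.toDual_apply_apply, one_mul] at h4
    exact h4
  have hmono : MonotoneOn φ (Set.Icc 0 1) := by
    refine monotoneOn_of_deriv_nonneg (convex_Icc 0 1)
      (fun t _ => (hderiv t).continuousAt.continuousWithinAt)
      (fun t _ => (hderiv t).differentiableAt.differentiableWithinAt) fun t ht => ?_
    rw [interior_Icc] at ht
    rw [(hderiv t).deriv, ← inner_sub_left]
    have h1 := hF.strong (x + t • v) x
    rw [add_sub_cancel_left, real_inner_smul_right] at h1
    have h2 : 0 ≤ t * inner ℝ (gradient F (x + t • v) - gradient F x) v :=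
      le_trans (by positivity) h1
    exact nonneg_of_mul_nonneg_right h2 ht.1
  have h := hmono (by simp) (by simp) (zero_le_one (α := ℝ))
  simp only [φ, zero_smul, add_zero, zero_mul, sub_zero, one_smul, one_mul, hv,
    add_sub_cancel] at h
  linarith

end DPOpt.IsSmoothStronglyConvex

/-- The summed gradient is strongly monotone with constant `n * μ`, hence has a zero; the summed
first-order inequalities turn it into a minimizer. -/
theorem exists_common_minimizer {n d : ℕ} [NeZero n] {F : Fin n → Vec d → ℝ} {L : Fin n → ℝ}
    (hL : ∀ i, 0 < L i) {μ : ℝ} (hμ : 0 < μ) (hF : ∀ i, IsSmoothStronglyConvex (F i) (L i) μ) :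
    ∃ p : Vec d, (∀ y, ∑ i, F i p ≤ ∑ i, F i y) ∧ ∑ i, gradient (F i) p = 0 := by
  obtain ⟨p, hp⟩ := exists_zero_of_lipschitz_of_strongly_monotone
    (H := fun x => ∑ i, gradient (F i) x) (Λ := ∑ i, L i) (m := n * μ)
    (Finset.sum_pos (fun i _ => hL i) Finset.univ_nonempty)
    (mul_pos (Nat.cast_pos.2 (NeZero.pos n)) hμ)
    (fun x y => by
      rw [← Finset.sum_sub_distrib, Finset.sum_mul]
      exact (norm_sum_le _ _).trans (Finset.sum_le_sum fun i _ => (hF i).lipschitz x y))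
    (fun x y => by
      rw [← Finset.sum_sub_distrib, sum_inner]
      calc (n : ℝ) * μ * ‖x - y‖ ^ 2 = ∑ _i : Fin n, μ * ‖x - y‖ ^ 2 := by simp; ring
        _ ≤ _ := Finset.sum_le_sum fun i _ => (hF i).strong x y)
  refine ⟨p, fun y => ?_, hp⟩
  have h := Finset.sum_le_sum fun i (_ : i ∈ Finset.univ) =>
    (hF i).add_inner_gradient_le hμ.le p y
  rwa [Finset.sum_add_distrib, ← sum_inner, hp, inner_zero_left, add_zero] at h

/-! ### Second moments and orthogonality -/

section SecondMoment

variable {Ω : Type*} [MeasurableSpace Ω] {P : Measure Ω}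

theorem memLp_two_and_integral_norm_sq_le {E : Type*} [NormedAddCommGroup E] {f : Ω → E} {c : ℝ}
    (hc : 0 ≤ c) (hf : AEStronglyMeasurable f P)
    (h : ∫⁻ ω, ENNReal.ofReal (‖f ω‖ ^ 2) ∂P ≤ ENNReal.ofReal c) :
    MemLp f 2 P ∧ ∫ ω, ‖f ω‖ ^ 2 ∂P ≤ c := by
  have h0 : 0 ≤ᵐ[P] fun ω => ‖f ω‖ ^ 2 := Eventually.of_forall fun ω => by positivity
  have hint : Integrable (fun ω => ‖f ω‖ ^ 2) P := by
    refine ⟨hf.norm.pow 2, ?_⟩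
    rw [hasFiniteIntegral_iff_ofReal h0]
    exact h.trans_lt ENNReal.ofReal_lt_top
  refine ⟨(memLp_two_iff_integrable_sq_norm hf).2 hint, ?_⟩
  rw [integral_eq_lintegral_of_nonneg_ae h0 hint.aestronglyMeasurable]
  exact ENNReal.toReal_le_of_le_ofReal hc h

theorem MeasureTheory.MemLp.integrable_norm_sq {E : Type*} [NormedAddCommGroup E] {f : Ω → E}
    (hf : MemLp f 2 P) : Integrable (fun ω => ‖f ω‖ ^ 2) P :=
  (memLp_two_iff_integrable_sq_norm hf.1).1 hf

variable {E : Type*} [NormedAddCommGroup E] [InnerProductSpace ℝ E]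

theorem MeasureTheory.MemLp.integrable_real_inner {f g : Ω → E} (hf : MemLp f 2 P)
    (hg : MemLp g 2 P) : Integrable (fun ω => inner ℝ (f ω) (g ω)) P := by
  refine (hf.integrable_norm_sq.add hg.integrable_norm_sq).mono' (hf.1.inner hg.1)
    (Eventually.of_forall fun ω => ?_)
  refine (norm_inner_le_norm _ _).trans ?_
  simp only [Pi.add_apply]
  nlinarith [sq_nonneg (‖f ω‖ - ‖g ω‖), sq_nonneg ‖f ω‖, sq_nonneg ‖g ω‖]

/-- Only orthogonality to `f` is required; the factors `2` replace any relation between `g` and `h`.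
-/
theorem integral_norm_add_add_sq_le {f g h : Ω → E} (hf : MemLp f 2 P) (hg : MemLp g 2 P)
    (hh : MemLp h 2 P) (hfg : ∫ ω, inner ℝ (f ω) (g ω) ∂P = 0)
    (hfh : ∫ ω, inner ℝ (f ω) (h ω) ∂P = 0) :
    ∫ ω, ‖f ω + g ω + h ω‖ ^ 2 ∂P ≤
      ∫ ω, ‖f ω‖ ^ 2 ∂P + (2 * ∫ ω, ‖g ω‖ ^ 2 ∂P + 2 * ∫ ω, ‖h ω‖ ^ 2 ∂P) := by
  have if2 := hf.integrable_norm_sq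
  have ig2 := hg.integrable_norm_sq.const_mul 2
  have ih2 := hh.integrable_norm_sq.const_mul 2
  have i1 := (hf.integrable_real_inner hg).const_mul 2
  have i2 := (hf.integrable_real_inner hh).const_mul 2
  calc ∫ ω, ‖f ω + g ω + h ω‖ ^ 2 ∂P ≤ ∫ ω, (‖f ω‖ ^ 2 + (2 * ‖g ω‖ ^ 2 + 2 * ‖h ω‖ ^ 2)
        + (2 * inner ℝ (f ω) (g ω) + 2 * inner ℝ (f ω) (h ω))) ∂P := by
        refine integral_mono ((hf.add hg).add hh).integrable_norm_sq
          ((if2.add (ig2.add ih2)).add (i1.add i2)) fun ω => ?_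
        have h1 := parallelogram_law_with_norm ℝ (g ω) (h ω)
        have h2 := sq_nonneg ‖g ω - h ω‖
        simp only
        rw [add_assoc, norm_add_sq_real, inner_add_right]
        linarith
    _ = (∫ ω, ‖f ω‖ ^ 2 ∂P + (∫ ω, 2 * ‖g ω‖ ^ 2 ∂P + ∫ ω, 2 * ‖h ω‖ ^ 2 ∂P))
        + (∫ ω, 2 * inner ℝ (f ω) (g ω) ∂P + ∫ ω, 2 * inner ℝ (f ω) (h ω) ∂P) := by
      have j1 : Integrable (fun ω => 2 * ‖g ω‖ ^ 2 + 2 * ‖h ω‖ ^ 2) P := ig2.add ih2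
      have j2 : Integrable (fun ω => ‖f ω‖ ^ 2 + (2 * ‖g ω‖ ^ 2 + 2 * ‖h ω‖ ^ 2)) P :=
        if2.add j1
      have j3 : Integrable (fun ω => 2 * inner ℝ (f ω) (g ω) + 2 * inner ℝ (f ω) (h ω)) P :=
        i1.add i2
      rw [← integral_add ig2 ih2, ← integral_add i1 i2, ← integral_add if2 j1,
        ← integral_add j2 j3]
    _ = _ := by
      simp only [integral_const_mul, hfg, hfh]
      ring

/-- By Fubini for the product law: with `U` frozen, the second factor has mean zero and the first is
constant. -/
theorem ProbabilityTheory.IndepFun.integral_inner_eq_zero [IsFiniteMeasure P] [CompleteSpace E]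
    [MeasurableSpace E] [BorelSpace E] [SecondCountableTopology E]
    {T Z : Type*} [MeasurableSpace T] [MeasurableSpace Z] {U : Ω → T} {V : Ω → Z}
    (h : IndepFun U V P) (hU : Measurable U) (hV : Measurable V) {p : T → E} (hp : Measurable p)
    {G : T → Z → E} (hG : Measurable (Function.uncurry G))
    (hint : ∀ u, Integrable (fun ω => G u (V ω)) P) (hzero : ∀ u, ∫ ω, G u (V ω) ∂P = 0)
    (hpG : Integrable (fun ω => inner ℝ (p (U ω)) (G (U ω) (V ω))) P) :
    ∫ ω, inner ℝ (p (U ω)) (G (U ω) (V ω)) ∂P = 0 := by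
  set F : T × Z → ℝ := fun q => inner ℝ (p q.1) (G q.1 q.2)
  have hF : Measurable F := (hp.comp measurable_fst).inner hG
  have hmap := h.map_prod_eq_prod_map_map hU.aemeasurable hV.aemeasurable
  have h1 : Integrable F ((P.map U).prod (P.map V)) := by
    rw [← hmap, integrable_map_measure hF.aestronglyMeasurable (hU.prodMk hV).aemeasurable]
    exact hpG
  have h2 : ∫ ω, inner ℝ (p (U ω)) (G (U ω) (V ω)) ∂P = ∫ q, F q ∂P.map fun ω => (U ω, V ω) := by
    rw [integral_map (hU.prodMk hV).aemeasurable hF.aestronglyMeasurable]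
  rw [h2, hmap, integral_prod _ h1]
  refine integral_eq_zero_of_ae (Eventually.of_forall fun u => ?_)
  have h3 : ∫ z, F (u, z) ∂P.map V = ∫ ω, inner ℝ (p u) (G u (V ω)) ∂P :=
    integral_map hV.aemeasurable (hF.comp measurable_prodMk_left).aestronglyMeasurable
  simp only [Pi.zero_apply]
  rw [h3, integral_inner (hint u), hzero, inner_zero_right]

end SecondMoment

/-- Averaging over `W` first leaves a function of `U` times an indicator of `V`. In the uses, `U` is
the past of one source of randomness, `V` its present, and `W` the past of the other source. -/
theorem ProbabilityTheory.IndepFun.prodMk_left_of_prodMk {Ω X Y Z : Type*} [MeasurableSpace Ω]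
    [MeasurableSpace X] [MeasurableSpace Y] [MeasurableSpace Z] {P : Measure Ω}
    [IsFiniteMeasure P] {U : Ω → X} {V : Ω → Y} {W : Ω → Z} (hU : Measurable U)
    (hV : Measurable V) (hW : Measurable W) (hUV : IndepFun U V P)
    (hUVW : IndepFun (fun ω => (U ω, V ω)) W P) :
    IndepFun (fun ω => (U ω, W ω)) V P := by
  have hUW : IndepFun U W P := hUVW.comp measurable_fst measurable_id
  rw [indepFun_iff_measure_inter_preimage_eq_mul]
  intro s t hs ht
  have e1 : ∀ {A : Set Ω}, MeasurableSet A → P A = ∫⁻ ω, A.indicator 1 ω ∂P := fun hA =>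
    (lintegral_indicator_one hA).symm
  have hsm : MeasurableSet ((fun ω => (U ω, W ω)) ⁻¹' s) := (hU.prodMk hW) hs
  have hsi : Measurable (s.indicator (1 : X × Z → ℝ≥0∞)) := measurable_one.indicator hs
  have hti : Measurable (t.indicator (1 : Y → ℝ≥0∞)) := measurable_one.indicator ht
  have i1 : P ((fun ω => (U ω, W ω)) ⁻¹' s ∩ V ⁻¹' t)
      = ∫⁻ ω, s.indicator 1 (U ω, W ω) * t.indicator 1 (V ω) ∂P := by
    rw [e1 (hsm.inter (hV ht)), Set.inter_indicator_one]
    rfl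
  have i2 : P ((fun ω => (U ω, W ω)) ⁻¹' s) = ∫⁻ ω, s.indicator 1 (U ω, W ω) ∂P := by
    rw [e1 hsm]; rfl
  have i3 : P (V ⁻¹' t) = ∫⁻ ω, t.indicator 1 (V ω) ∂P := by
    rw [e1 (hV ht)]; rfl
  rw [i1, hUVW.lintegral_uncurry
    (F := fun (q : X × Y) z => s.indicator 1 (q.1, z) * t.indicator 1 q.2)
    (hU.prodMk hV) hW ((hsi.comp (by fun_prop)).mul (hti.comp (by fun_prop)))]
  have i4 : ∀ ω, ∫⁻ ω', s.indicator 1 (U ω, W ω') * t.indicator 1 (V ω) ∂P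
      = (fun u => ∫⁻ ω', s.indicator (1 : X × Z → ℝ≥0∞) (u, W ω') ∂P) (U ω)
        * t.indicator 1 (V ω) := fun ω =>
    lintegral_mul_const _ (hsi.comp (by fun_prop))
  simp_rw [i4]
  have hm : Measurable fun u => ∫⁻ ω', s.indicator (1 : X × Z → ℝ≥0∞) (u, W ω') ∂P :=
    Measurable.lintegral_prod_right' (f := fun q : X × Ω => s.indicator 1 (q.1, W q.2))
      (hsi.comp (by fun_prop))
  rw [hUV.lintegral_uncurry (F := fun u v =>
    (∫⁻ ω', s.indicator (1 : X × Z → ℝ≥0∞) (u, W ω') ∂P) * t.indicator 1 v) hU hV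
    ((hm.comp measurable_fst).mul (hti.comp measurable_snd))]
  have i5 : ∀ ω, ∫⁻ ω', (∫⁻ ω'', s.indicator (1 : X × Z → ℝ≥0∞) (U ω, W ω'') ∂P)
      * t.indicator 1 (V ω') ∂P
      = (∫⁻ ω'', s.indicator (1 : X × Z → ℝ≥0∞) (U ω, W ω'') ∂P) * P (V ⁻¹' t) := fun ω => by
    rw [i3]
    exact lintegral_const_mul _ (hti.comp hV)
  simp_rw [i5]
  refine (lintegral_mul_const _ (hm.comp hU)).trans ?_
  rw [i2, hUW.lintegral_uncurry
    (F := fun u w => s.indicator 1 (u, w)) hU hW hsi]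
  rfl

/-! ### Moments of the Laplace noise -/

namespace DPOpt.IsLaplaceNoise

variable {n d : ℕ} {Ω : Type*} [MeasurableSpace Ω] {P : Measure Ω} {σ : ℕ → ℝ}
  {ν : ℕ → Fin n → Ω → Vec d}

theorem measurable_coord (hν : IsLaplaceNoise P σ ν) (k : ℕ) (i : Fin n) (c : Fin d) :
    Measurable fun ω => ν k i ω c :=
  (EuclideanSpace.proj (𝕜 := ℝ) c).continuous.measurable.comp (hν.measurable k i)

theorem memLp_and_integral_norm_sq_le (hν : IsLaplaceNoise P σ ν) {k : ℕ} (hσ : 0 < σ k)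
    (i : Fin n) : MemLp (ν k i) 2 P ∧ ∫ ω, ‖ν k i ω‖ ^ 2 ∂P ≤ d * (2 * σ k ^ 2) := by
  refine memLp_two_and_integral_norm_sq_le (by positivity)
    (hν.measurable k i).aestronglyMeasurable (le_of_eq ?_)
  have h1 : ∀ ω, ENNReal.ofReal (‖ν k i ω‖ ^ 2) = ∑ c, ENNReal.ofReal (ν k i ω c ^ 2) := by
    intro ω
    rw [EuclideanSpace.norm_sq_eq, ← ENNReal.ofReal_sum_of_nonneg fun c _ => by positivity]
    simp
  simp_rw [h1]
  rw [lintegral_finsetSum _ fun c _ =>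
    ((hν.measurable_coord k i c).pow_const 2).ennreal_ofReal]
  have h2 : ∀ c, ∫⁻ ω, ENNReal.ofReal (ν k i ω c ^ 2) ∂P = ENNReal.ofReal (2 * σ k ^ 2) := by
    intro c
    rw [← lintegral_sq_laplace hσ, ← hν.law k i c,
      lintegral_map (by fun_prop) (hν.measurable_coord k i c)]
  simp_rw [h2]
  rw [Finset.sum_const, Finset.card_univ, Fintype.card_fin, nsmul_eq_mul,
    ENNReal.ofReal_mul (Nat.cast_nonneg d), ENNReal.ofReal_natCast]

theorem integral_eq_zero [IsProbabilityMeasure P] (hν : IsLaplaceNoise P σ ν) {k : ℕ}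
    (hσ : 0 < σ k) (i : Fin n) : ∫ ω, ν k i ω ∂P = 0 := by
  have hint : Integrable (ν k i) P :=
    (hν.memLp_and_integral_norm_sq_le hσ i).1.integrable (by norm_num)
  ext c
  have h1 : ∫ ω, ν k i ω c ∂P = (∫ ω, ν k i ω ∂P) c :=
    (EuclideanSpace.proj (𝕜 := ℝ) c : Vec d →L[ℝ] ℝ).integral_comp_comm hint
  have h2 : ∫ ω, ν k i ω c ∂P = 0 := by
    rw [← integral_id_laplace hσ, ← hν.law k i c,
      integral_map (hν.measurable_coord k i c).aemeasurable (by fun_prop)]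
  rw [← h1, h2]
  rfl

end DPOpt.IsLaplaceNoise

/-! ### Stochastic gradients along a random point -/

namespace DPOpt

variable {d : ℕ} {S : Type*} [MeasurableSpace S] {𝒟 : Measure S} {F : Vec d → ℝ} {L μ s : ℝ}
  {g : Vec d → S → Vec d}

theorem IsSmoothStronglyConvex.measurable_gradient (hF : IsSmoothStronglyConvex F L μ) :
    Measurable (gradient F) := by
  have h : LipschitzWith L.toNNReal (gradient F) := LipschitzWith.of_dist_le_mul fun x y => by
    rw [dist_eq_norm, dist_eq_norm]
    exact (hF.lipschitz x y).trans
      (mul_le_mul_of_nonneg_right (Real.le_coe_toNNReal L) (norm_nonneg _))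
  exact h.continuous.measurable

theorem IsSmoothStronglyConvex.memLp_gradient_comp {Ω : Type*} [MeasurableSpace Ω]
    {P : Measure Ω} [IsFiniteMeasure P] (hF : IsSmoothStronglyConvex F L μ) {X : Ω → Vec d}
    (hX : MemLp X 2 P) : MemLp (fun ω => gradient F (X ω)) 2 P := by
  have h1 : MemLp (fun ω => |L| * ‖X ω‖ + ‖gradient F 0‖) 2 P :=
    (hX.norm.const_mul _).add (memLp_const _)
  refine h1.mono (hF.measurable_gradient.comp_aemeasurable hX.1.aemeasurable).aestronglyMeasurable
    (Eventually.of_forall fun ω => ?_)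
  rw [Real.norm_of_nonneg (by positivity)]
  have h2 := hF.lipschitz (X ω) 0
  have h3 := norm_le_norm_sub_add (gradient F (X ω)) (gradient F 0)
  rw [sub_zero] at h2
  have h4 := mul_le_mul_of_nonneg_right (le_abs_self L) (norm_nonneg (X ω))
  linarith

namespace IsStochasticGradient

theorem measurable_error (hg : IsStochasticGradient 𝒟 F g s) (hF : Measurable (gradient F)) :
    Measurable (Function.uncurry fun x z => g x z - gradient F x) :=
  hg.measurable.sub (hF.comp measurable_fst)

theorem lintegral_error_sq_le [IsProbabilityMeasure 𝒟]
    (hg : IsStochasticGradient 𝒟 F g s) (x : Vec d) :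
    ∫⁻ z, ENNReal.ofReal (‖g x z - gradient F x‖ ^ 2) ∂𝒟 ≤ ENNReal.ofReal (s ^ 2) := by
  have h1 : MemLp (fun z => g x z - gradient F x) 2 𝒟 := (hg.memLp x).sub (memLp_const _)
  rw [← ofReal_integral_eq_lintegral_ofReal h1.integrable_norm_sq
    (Eventually.of_forall fun z => by positivity)]
  exact ENNReal.ofReal_le_ofReal (hg.variance x)

theorem integral_error [IsProbabilityMeasure 𝒟] (hg : IsStochasticGradient 𝒟 F g s) (x : Vec d) :
    ∫ z, (g x z - gradient F x) ∂𝒟 = 0 := by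
  rw [integral_sub ((hg.memLp x).integrable (by norm_num)) (integrable_const _), hg.unbiased]
  simp

variable {Ω : Type*} [MeasurableSpace Ω] {P : Measure Ω} [IsProbabilityMeasure P]

/-- The variance bound is known only at fixed points; independence allows the random point to be
frozen. -/
theorem memLp_error_comp_and_le [IsProbabilityMeasure 𝒟]
    (hg : IsStochasticGradient 𝒟 F g s) (hF : Measurable (gradient F))
    {X : Ω → Vec d} {V : Ω → S} (hX : Measurable X) (hV : Measurable V) (hlaw : P.map V = 𝒟)
    (hXV : IndepFun X V P) : MemLp (fun ω => g (X ω) (V ω) - gradient F (X ω)) 2 P ∧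
      ∫ ω, ‖g (X ω) (V ω) - gradient F (X ω)‖ ^ 2 ∂P ≤ s ^ 2 := by
  have hm := hg.measurable_error hF
  refine memLp_two_and_integral_norm_sq_le (by positivity)
    (hm.comp (hX.prodMk hV)).aestronglyMeasurable ?_
  have hm2 : Measurable (Function.uncurry fun x z =>
      ENNReal.ofReal (‖g x z - gradient F x‖ ^ 2)) := (hm.norm.pow_const 2).ennreal_ofReal
  rw [hXV.lintegral_uncurry (F := fun x z => ENNReal.ofReal (‖g x z - gradient F x‖ ^ 2)) hX hV
    hm2]
  have h1 : ∀ ω, ∫⁻ ω', ENNReal.ofReal (‖g (X ω) (V ω') - gradient F (X ω)‖ ^ 2) ∂P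
      ≤ ENNReal.ofReal (s ^ 2) := by
    intro ω
    refine le_trans (le_of_eq ?_) (hg.lintegral_error_sq_le (X ω))
    rw [← hlaw]
    exact (lintegral_map (hm2.comp measurable_prodMk_left) hV).symm
  calc _ ≤ ∫⁻ _, ENNReal.ofReal (s ^ 2) ∂P := lintegral_mono h1
    _ = _ := by simp

end IsStochasticGradient

end DPOpt

/-! ### The states of the algorithm as random variables -/

namespace DPOpt.Alg

variable {n d : ℕ} (a : Alg n d) {S : Fin n → Type*} {g : ∀ i, Vec d → S i → Vec d} {Ω : Type*}
  {ξ : ℕ → ∀ i, ℕ → Ω → S i} {ν : ℕ → Fin n → Ω → Vec d}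

/-- The random state at iteration `k`. -/
noncomputable def randomState (g : ∀ i, Vec d → S i → Vec d) (ξ : ℕ → ∀ i, ℕ → Ω → S i)
    (ν : ℕ → Fin n → Ω → Vec d) (k : ℕ) (ω : Ω) : Profile n d :=
  a.iterate g (fun k i l => ξ k i l ω) (fun k j => ν k j ω) k

/-- The effect of the privacy noise on the step of agent `i`. -/
noncomputable def noiseTerm (k : ℕ) (v : Profile n d) (i : Fin n) : Vec d :=
  a.mixStep k • ∑ j, a.A i j • v j

/-- The effect of the gradient error on the step of agent `i`, at the states `x` and with the
samples `z`. -/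
noncomputable def errorTerm (F : Fin n → Vec d → ℝ) (g : ∀ i, Vec d → S i → Vec d) (k : ℕ)
    (x : Profile n d) (z : ∀ i, ℕ → S i) (i : Fin n) : Vec d :=
  -(a.gradStep k • ∑ l ∈ Finset.range (a.batch k),
    (1 / (a.batch k : ℝ)) • (g i (x i) (z i l) - gradient (F i) (x i)))

/-- The noiseless step of agent `i`, relative to `p`. -/
noncomputable def meanStep (F : Fin n → Vec d → ℝ) (k : ℕ) (p : Vec d) (x : Profile n d)
    (i : Fin n) : Vec d :=
  (1 - a.mixStep k) • x i + a.mixStep k • ∑ j, a.A i j • x j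
    - a.gradStep k • gradient (F i) (x i) - p

/-- Splits a step into a function of the current state and two perturbations with conditional mean
zero. A nonempty batch is needed for the averaged gradients to be centred. -/
theorem randomState_succ_sub {k : ℕ} (hb : a.batch k ≠ 0) (F : Fin n → Vec d → ℝ) (p : Vec d)
    (ω : Ω) (i : Fin n) :
    a.randomState g ξ ν (k + 1) ω i - p = a.meanStep F k p (a.randomState g ξ ν k ω) i
      + a.noiseTerm k (fun j => ν k j ω) i
      + a.errorTerm F g k (a.randomState g ξ ν k ω) (fun i l => ξ k i l ω) i := by
  have hb' : (a.batch k : ℝ) ≠ 0 := Nat.cast_ne_zero.2 hb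
  have h1 : ∀ (v : ℕ → Vec d) (u : Vec d), ∑ l ∈ Finset.range (a.batch k),
      (1 / (a.batch k : ℝ)) • (v l - u)
      = (1 / (a.batch k : ℝ)) • ∑ l ∈ Finset.range (a.batch k), v l - u := by
    intro v u
    rw [← Finset.smul_sum, Finset.sum_sub_distrib, Finset.sum_const, Finset.card_range, smul_sub,
      ← Nat.cast_smul_eq_nsmul ℝ, smul_smul, one_div_mul_cancel hb', one_smul]
  simp only [randomState, Alg.iterate, step, meanStep, noiseTerm, errorTerm, h1, smul_add,
    Finset.sum_add_distrib]
  module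

theorem exists_iterate_eq [∀ i, MeasurableSpace (S i)]
    (hg : ∀ i, Measurable (Function.uncurry (g i))) (k : ℕ) :
    ∃ Φ : (Fin k → Profile n d) × (Fin k → ∀ i, ℕ → S i) → Profile n d, Measurable Φ ∧
      ∀ (ξ : ℕ → ∀ i, ℕ → S i) (ν : ℕ → Profile n d),
        a.iterate g ξ ν k = Φ (fun j => ν j, fun j => ξ j) := by
  induction k with
  | zero => exact ⟨fun _ => a.init, measurable_const, fun _ _ => rfl⟩
  | succ k ih =>
    obtain ⟨Φ, hΦ, h⟩ := ih
    set Ψ : (Fin (k + 1) → Profile n d) × (Fin (k + 1) → ∀ i, ℕ → S i) → Profile n d :=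
      fun r => Φ (fun j => r.1 j.castSucc, fun j => r.2 j.castSucc)
    have hΨ : Measurable Ψ := hΦ.comp (by fun_prop)
    have hv : Measurable fun r : (Fin (k + 1) → Profile n d) × (Fin (k + 1) → ∀ i, ℕ → S i) =>
        r.1 (Fin.last k) := by fun_prop
    refine ⟨fun r => a.step k (Ψ r) (fun j => Ψ r j + r.1 (Fin.last k) j)
      fun i l => g i (Ψ r i) (r.2 (Fin.last k) i l), ?_, fun ξ ν => ?_⟩
    · refine a.measurable_step_comp k hΨ (hΨ.add hv) fun i l => ?_
      exact (hg i).comp ((measurable_pi_iff.1 hΨ i).prodMk (by fun_prop))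
    · simp only [Alg.iterate, h]
      rfl

variable [∀ i, MeasurableSpace (S i)] [MeasurableSpace Ω] {P : Measure Ω} {𝒟 : ∀ i, Measure (S i)}
  {σ : ℕ → ℝ}

theorem measurable_randomState (hg : ∀ i, Measurable (Function.uncurry (g i)))
    (hξ : IsSampling 𝒟 P ξ) (hν : IsLaplaceNoise P σ ν) (k : ℕ) :
    Measurable (a.randomState g ξ ν k) := by
  obtain ⟨Φ, hΦ, h⟩ := a.exists_iterate_eq hg k
  unfold randomState
  simp_rw [h]
  refine hΦ.comp (Measurable.prodMk (measurable_pi_iff.2 fun j => hν.measurable_profile j) ?_)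
  have := hξ.measurable
  fun_prop

/-- The state depends on past samples and past noises: the former are independent of the current
samples, and the noises of all samples together. -/
theorem indepFun_randomState_sample [IsProbabilityMeasure P]
    (hg : ∀ i, Measurable (Function.uncurry (g i)))
    (hξ : IsSampling 𝒟 P ξ) (hν : IsLaplaceNoise P σ ν)
    (hξν : IndepFun (fun ω k i l => ξ k i l ω) (fun ω k i => ν k i ω) P) (k : ℕ) :
    IndepFun (a.randomState g ξ ν k) (fun ω i l => ξ k i l ω) P := by
  obtain ⟨Φ, hΦ, h⟩ := a.exists_iterate_eq hg k
  have hm : ∀ k, Measurable fun ω i l => ξ k i l ω := fun k => by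
    have := hξ.measurable k
    fun_prop
  have h1 := hξ.indep.indepFun_past hm k
  have h2 : IndepFun (fun ω => ((fun (j : Fin k) i l => ξ j i l ω), fun i l => ξ k i l ω))
      (fun ω (j : Fin k) i => ν j i ω) P :=
    hξν.comp (φ := fun z => ((fun j : Fin k => z j), z k)) (ψ := fun z (j : Fin k) => z j)
      (by fun_prop) (by fun_prop)
  have h3 := IndepFun.prodMk_left_of_prodMk (measurable_pi_iff.2 fun j : Fin k => hm j) (hm k)
    (measurable_pi_iff.2 fun j : Fin k => hν.measurable_profile j) h1 h2
  have h4 := h3.comp (hΦ.comp measurable_swap) measurable_id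
  unfold randomState
  simp_rw [h]
  exact h4

theorem indepFun_randomState_noise [IsProbabilityMeasure P]
    (hg : ∀ i, Measurable (Function.uncurry (g i)))
    (hξ : IsSampling 𝒟 P ξ) (hν : IsLaplaceNoise P σ ν)
    (hξν : IndepFun (fun ω k i l => ξ k i l ω) (fun ω k i => ν k i ω) P) (k : ℕ) :
    IndepFun (a.randomState g ξ ν k) (fun ω i => ν k i ω) P := by
  obtain ⟨Φ, hΦ, h⟩ := a.exists_iterate_eq hg k
  have hm : Measurable fun ω (j : Fin k) i l => ξ j i l ω := by
    have := hξ.measurable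
    fun_prop
  have h2 : IndepFun (fun ω => ((fun (j : Fin k) i => ν j i ω), fun i => ν k i ω))
      (fun ω (j : Fin k) i l => ξ j i l ω) P :=
    hξν.symm.comp (φ := fun z => ((fun j : Fin k => z j), z k)) (ψ := fun z (j : Fin k) => z j)
      (by fun_prop) (by fun_prop)
  have h3 := IndepFun.prodMk_left_of_prodMk
    (measurable_pi_iff.2 fun j : Fin k => hν.measurable_profile j)
    (hν.measurable_profile k) hm (hν.indepFun_past k) h2
  have h4 := h3.comp hΦ measurable_id
  unfold randomState
  simp_rw [h]
  exact h4

end DPOpt.Alg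

/-! ### The mean-square recursion -/

theorem memLp_sum_smul {Ω ι E : Type*} [MeasurableSpace Ω] {P : Measure Ω}
    [NormedAddCommGroup E] [NormedSpace ℝ E] (s : Finset ι) (w : ι → ℝ) {v : ι → Ω → E}
    (hv : ∀ i ∈ s, MemLp (v i) 2 P) : MemLp (fun ω => ∑ i ∈ s, w i • v i ω) 2 P :=
  memLp_finsetSum s fun i hi => (hv i hi).const_smul (w i)

/-- Convexity in place of independence, so the `v i` may be correlated. It serves both the weights
`a_{ij}` and the batch average; samples within a batch need not be independent, and batch size
brings no gain here. -/
theorem integral_norm_smul_sum_smul_sq_le {Ω ι E : Type*} [MeasurableSpace Ω] {P : Measure Ω}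
    [NormedAddCommGroup E] [NormedSpace ℝ E] (s : Finset ι) {w : ι → ℝ}
    (hw : ∀ i ∈ s, 0 ≤ w i) (hw1 : ∑ i ∈ s, w i = 1) {v : ι → Ω → E} {c : ℝ} (r : ℝ)
    (hv : ∀ i ∈ s, MemLp (v i) 2 P ∧ ∫ ω, ‖v i ω‖ ^ 2 ∂P ≤ c) :
    ∫ ω, ‖r • ∑ i ∈ s, w i • v i ω‖ ^ 2 ∂P ≤ r ^ 2 * c := by
  have h0 : ∀ ω, ‖r • ∑ i ∈ s, w i • v i ω‖ ^ 2 = r ^ 2 * ‖∑ i ∈ s, w i • v i ω‖ ^ 2 :=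
    fun ω => by rw [norm_smul, mul_pow, Real.norm_eq_abs, sq_abs]
  simp_rw [h0]
  rw [integral_const_mul]
  gcongr
  have hint : ∀ i ∈ s, Integrable (fun ω => w i * ‖v i ω‖ ^ 2) P := fun i hi =>
    (hv i hi).1.integrable_norm_sq.const_mul _
  calc ∫ ω, ‖∑ i ∈ s, w i • v i ω‖ ^ 2 ∂P ≤ ∫ ω, ∑ i ∈ s, w i * ‖v i ω‖ ^ 2 ∂P :=
        integral_mono (memLp_sum_smul s w fun i hi => (hv i hi).1).integrable_norm_sq
          (integrable_finsetSum s hint) fun ω => norm_sum_smul_sq_le s hw hw1 fun i => v i ω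
    _ = ∑ i ∈ s, w i * ∫ ω, ‖v i ω‖ ^ 2 ∂P := by
      rw [integral_finsetSum s hint]
      simp_rw [integral_const_mul]
    _ ≤ ∑ i ∈ s, w i * c :=
      Finset.sum_le_sum fun i hi => mul_le_mul_of_nonneg_left (hv i hi).2 (hw i hi)
    _ = c := by rw [← Finset.sum_mul, hw1, one_mul]

namespace DPOpt.Alg

variable {n d : ℕ} (a : Alg n d) {S : Fin n → Type*} [∀ i, MeasurableSpace (S i)]
  {g : ∀ i, Vec d → S i → Vec d} {Ω : Type*} [MeasurableSpace Ω] {P : Measure Ω}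
  {ξ : ℕ → ∀ i, ℕ → Ω → S i} {ν : ℕ → Fin n → Ω → Vec d} {𝒟 : ∀ i, Measure (S i)} {σ : ℕ → ℝ}
  {F : Fin n → Vec d → ℝ} {L : Fin n → ℝ} {μ s : ℝ}

theorem memLp_noiseTerm (hν : IsLaplaceNoise P σ ν) {k : ℕ} (hσ : 0 < σ k) (i : Fin n) :
    MemLp (fun ω => a.noiseTerm k (fun j => ν k j ω) i) 2 P := by
  have h1 := memLp_sum_smul Finset.univ (a.A i) (v := ν k) (P := P)
    fun j _ => (hν.memLp_and_integral_norm_sq_le hσ j).1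
  exact h1.const_smul (a.mixStep k)

theorem integral_norm_noiseTerm_sq_le (hν : IsLaplaceNoise P σ ν) {k : ℕ} (hσ : 0 < σ k)
    (hA : a.A ∈ doublyStochastic ℝ (Fin n)) (i : Fin n) :
    ∫ ω, ‖a.noiseTerm k (fun j => ν k j ω) i‖ ^ 2 ∂P ≤
      a.mixStep k ^ 2 * (d * (2 * σ k ^ 2)) := by
  obtain ⟨h0, hrow, -⟩ := mem_doublyStochastic_iff_sum.1 hA
  exact integral_norm_smul_sum_smul_sq_le Finset.univ (fun j _ => h0 i j) (hrow i) _
    fun j _ => hν.memLp_and_integral_norm_sq_le hσ j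

theorem integral_noiseTerm [IsProbabilityMeasure P] (hν : IsLaplaceNoise P σ ν) {k : ℕ}
    (hσ : 0 < σ k) (i : Fin n) : ∫ ω, a.noiseTerm k (fun j => ν k j ω) i ∂P = 0 := by
  unfold noiseTerm
  rw [integral_smul, integral_finsetSum]
  · simp_rw [integral_smul, hν.integral_eq_zero hσ]
    simp
  · intro j _
    have h := (hν.memLp_and_integral_norm_sq_le hσ j).1.integrable (by norm_num)
    exact h.smul (a.A i j)

theorem measurable_noiseTerm (k : ℕ) (i : Fin n) :
    Measurable fun v : Profile n d => a.noiseTerm k v i := by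
  unfold noiseTerm
  fun_prop

theorem measurable_errorTerm (hF : ∀ i, Measurable (gradient (F i)))
    (hg : ∀ i, Measurable (Function.uncurry (g i))) (k : ℕ) (i : Fin n) :
    Measurable (Function.uncurry fun (x : Profile n d) (z : ∀ i, ℕ → S i) =>
      a.errorTerm F g k x z i) := by
  have h1 : ∀ l, Measurable fun q : Profile n d × (∀ i, ℕ → S i) => g i (q.1 i) (q.2 i l) :=
    fun l => (hg i).comp (Measurable.prodMk (by fun_prop) (by fun_prop))
  have h2 : Measurable fun q : Profile n d × (∀ i, ℕ → S i) => gradient (F i) (q.1 i) :=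
    (hF i).comp (by fun_prop)
  unfold errorTerm Function.uncurry
  fun_prop

theorem measurable_meanStep (hF : ∀ i, Measurable (gradient (F i))) (k : ℕ) (p : Vec d)
    (i : Fin n) : Measurable fun x : Profile n d => a.meanStep F k p x i := by
  have h2 : Measurable fun x : Profile n d => gradient (F i) (x i) := (hF i).comp (by fun_prop)
  unfold meanStep
  fun_prop

section Samples

variable [∀ i, IsProbabilityMeasure (𝒟 i)]

theorem integrable_and_integral_error (hg : ∀ i, IsStochasticGradient (𝒟 i) (F i) (g i) s)
    (hξ : IsSampling 𝒟 P ξ) (k : ℕ) (x : Vec d) (i : Fin n) (l : ℕ) :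
    Integrable (fun ω => g i x (ξ k i l ω) - gradient (F i) x) P ∧
      ∫ ω, (g i x (ξ k i l ω) - gradient (F i) x) ∂P = 0 := by
  have hgm : Measurable (g i x) := (hg i).measurable.comp measurable_prodMk_left
  have h1 : Integrable (fun z => g i x z - gradient (F i) x) (𝒟 i) :=
    (((hg i).memLp x).integrable (by norm_num)).sub (integrable_const _)
  have h2 := (hg i).integral_error x
  rw [← hξ.law k i l] at h1 h2
  refine ⟨h1.comp_measurable (hξ.measurable k i l), ?_⟩
  rwa [integral_map (hξ.measurable k i l).aemeasurable h1.aestronglyMeasurable] at h2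

theorem integrable_and_integral_errorTerm
    (hg : ∀ i, IsStochasticGradient (𝒟 i) (F i) (g i) s)
    (hξ : IsSampling 𝒟 P ξ) (k : ℕ) (x : Profile n d) (i : Fin n) :
    Integrable (fun ω => a.errorTerm F g k x (fun i l => ξ k i l ω) i) P ∧
      ∫ ω, a.errorTerm F g k x (fun i l => ξ k i l ω) i ∂P = 0 := by
  have h1 := fun l => integrable_and_integral_error hg hξ k (x i) i l
  have h2 : ∀ l ∈ Finset.range (a.batch k), Integrable (fun ω => (1 / (a.batch k : ℝ)) •
      (g i (x i) (ξ k i l ω) - gradient (F i) (x i))) P := fun l _ =>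
      (h1 l).1.smul (1 / (a.batch k : ℝ))
  unfold errorTerm
  refine ⟨((integrable_finsetSum _ h2).smul (a.gradStep k)).neg, ?_⟩
  rw [integral_neg, integral_smul, integral_finsetSum _ h2]
  simp_rw [integral_smul, (h1 _).2]
  simp

variable [IsProbabilityMeasure P]

/-- The error of one sampled gradient at the random state. -/
theorem memLp_sampleError_and_le (hF : ∀ i, IsSmoothStronglyConvex (F i) (L i) μ)
    (hg : ∀ i, IsStochasticGradient (𝒟 i) (F i) (g i) s) (hξ : IsSampling 𝒟 P ξ)
    (hν : IsLaplaceNoise P σ ν)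
    (hξν : IndepFun (fun ω k i l => ξ k i l ω) (fun ω k i => ν k i ω) P)
    (k : ℕ) (i : Fin n) (l : ℕ) :
    MemLp (fun ω => g i (a.randomState g ξ ν k ω i) (ξ k i l ω)
        - gradient (F i) (a.randomState g ξ ν k ω i)) 2 P ∧
      ∫ ω, ‖g i (a.randomState g ξ ν k ω i) (ξ k i l ω)
        - gradient (F i) (a.randomState g ξ ν k ω i)‖ ^ 2 ∂P ≤ s ^ 2 := by
  have hgm := fun i => (hg i).measurable
  exact (hg i).memLp_error_comp_and_le (hF i).measurable_gradient
    (measurable_pi_iff.1 (a.measurable_randomState hgm hξ hν k) i) (hξ.measurable k i l)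
    (hξ.law k i l) ((a.indepFun_randomState_sample hgm hξ hν hξν k).comp
      (measurable_pi_apply i) ((measurable_pi_apply l).comp (measurable_pi_apply i)))

theorem memLp_errorTerm (hF : ∀ i, IsSmoothStronglyConvex (F i) (L i) μ)
    (hg : ∀ i, IsStochasticGradient (𝒟 i) (F i) (g i) s) (hξ : IsSampling 𝒟 P ξ)
    (hν : IsLaplaceNoise P σ ν)
    (hξν : IndepFun (fun ω k i l => ξ k i l ω) (fun ω k i => ν k i ω) P) (k : ℕ) (i : Fin n) :
    MemLp (fun ω => a.errorTerm F g k (a.randomState g ξ ν k ω)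
      (fun i l => ξ k i l ω) i) 2 P := by
  have h1 := memLp_sum_smul (Finset.range (a.batch k)) (fun _ => 1 / (a.batch k : ℝ))
    fun l _ => (a.memLp_sampleError_and_le hF hg hξ hν hξν k i l).1
  exact (h1.const_smul (a.gradStep k)).neg

theorem integral_norm_errorTerm_sq_le (hF : ∀ i, IsSmoothStronglyConvex (F i) (L i) μ)
    (hg : ∀ i, IsStochasticGradient (𝒟 i) (F i) (g i) s) (hξ : IsSampling 𝒟 P ξ)
    (hν : IsLaplaceNoise P σ ν)
    (hξν : IndepFun (fun ω k i l => ξ k i l ω) (fun ω k i => ν k i ω) P) {k : ℕ}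
    (hb : a.batch k ≠ 0) (i : Fin n) :
    ∫ ω, ‖a.errorTerm F g k (a.randomState g ξ ν k ω) (fun i l => ξ k i l ω) i‖ ^ 2 ∂P ≤
      a.gradStep k ^ 2 * s ^ 2 := by
  simp only [errorTerm, norm_neg]
  refine integral_norm_smul_sum_smul_sq_le (Finset.range (a.batch k))
    (w := fun _ => 1 / (a.batch k : ℝ)) (fun _ _ => by positivity) ?_ (a.gradStep k)
    fun l _ => a.memLp_sampleError_and_le hF hg hξ hν hξν k i l
  rw [Finset.sum_const, Finset.card_range, nsmul_eq_mul,
    mul_one_div_cancel (Nat.cast_ne_zero.2 hb)]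

theorem memLp_meanStep (hF : ∀ i, IsSmoothStronglyConvex (F i) (L i) μ) {X : Ω → Profile n d}
    (hX : ∀ i, MemLp (fun ω => X ω i) 2 P) (k : ℕ) (p : Vec d) (i : Fin n) :
    MemLp (fun ω => a.meanStep F k p (X ω) i) 2 P := by
  have h1 := (hX i).const_smul (1 - a.mixStep k)
  have h2 := (memLp_sum_smul Finset.univ (a.A i) fun j _ => hX j).const_smul (a.mixStep k)
  have h3 := ((hF i).memLp_gradient_comp (hX i)).const_smul (a.gradStep k)
  exact ((h1.add h2).sub h3).sub (memLp_const p)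

theorem memLp_randomState (hF : ∀ i, IsSmoothStronglyConvex (F i) (L i) μ)
    (hg : ∀ i, IsStochasticGradient (𝒟 i) (F i) (g i) s) (hξ : IsSampling 𝒟 P ξ)
    (hν : IsLaplaceNoise P σ ν)
    (hξν : IndepFun (fun ω k i l => ξ k i l ω) (fun ω k i => ν k i ω) P) (hσ : ∀ k, 0 < σ k)
    (hb : ∀ k, a.batch k ≠ 0) (k : ℕ) (i : Fin n) :
    MemLp (fun ω => a.randomState g ξ ν k ω i) 2 P := by
  induction k generalizing i with
  | zero => exact memLp_const (a.init i)
  | succ k ih =>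
    have h1 := ((a.memLp_meanStep hF ih k 0 i).add (a.memLp_noiseTerm hν (hσ k) i)).add
      (a.memLp_errorTerm hF hg hξ hν hξν k i)
    refine h1.ae_eq (Eventually.of_forall fun ω => ?_)
    have h2 := a.randomState_succ_sub (g := g) (ξ := ξ) (ν := ν) (hb k) F 0 ω i
    rw [sub_zero] at h2
    exact h2.symm

theorem integral_norm_randomState_succ_sub_sq_le
    (hA : a.A ∈ doublyStochastic ℝ (Fin n))
    (hF : ∀ i, IsSmoothStronglyConvex (F i) (L i) μ)
    (hg : ∀ i, IsStochasticGradient (𝒟 i) (F i) (g i) s) (hξ : IsSampling 𝒟 P ξ)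
    (hν : IsLaplaceNoise P σ ν)
    (hξν : IndepFun (fun ω k i l => ξ k i l ω) (fun ω k i => ν k i ω) P) (hσ : ∀ k, 0 < σ k)
    (hb : ∀ k, a.batch k ≠ 0) (p : Vec d) (k : ℕ) (i : Fin n) :
    ∫ ω, ‖a.randomState g ξ ν (k + 1) ω i - p‖ ^ 2 ∂P ≤
      ∫ ω, ‖a.meanStep F k p (a.randomState g ξ ν k ω) i‖ ^ 2 ∂P +
        (2 * (a.mixStep k ^ 2 * (d * (2 * σ k ^ 2))) + 2 * (a.gradStep k ^ 2 * s ^ 2)) := by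
  have hgm := fun i => (hg i).measurable
  have hFm := fun i => (hF i).measurable_gradient
  have hX := a.memLp_randomState hF hg hξ hν hξν hσ hb k
  have hmean := a.memLp_meanStep hF hX k p i
  have hnoise := a.memLp_noiseTerm hν (hσ k) i
  have herr := a.memLp_errorTerm hF hg hξ hν hξν k i
  have hXm := a.measurable_randomState hgm hξ hν k
  have h1 := (a.indepFun_randomState_noise hgm hξ hν hξν k).integral_inner_eq_zero hXm
    (hν.measurable_profile k) (a.measurable_meanStep hFm k p i)
    (G := fun _ v => a.noiseTerm k v i) ((a.measurable_noiseTerm k i).comp measurable_snd)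
    (fun _ => hnoise.integrable (by norm_num)) (fun _ => a.integral_noiseTerm hν (hσ k) i)
    (hmean.integrable_real_inner hnoise)
  have hξm : Measurable fun ω i l => ξ k i l ω := by
    have := hξ.measurable k
    fun_prop
  have h2 := (a.indepFun_randomState_sample hgm hξ hν hξν k).integral_inner_eq_zero hXm
    hξm (a.measurable_meanStep hFm k p i)
    (G := fun x z => a.errorTerm F g k x z i) (a.measurable_errorTerm hFm hgm k i)
    (fun x => (a.integrable_and_integral_errorTerm hg hξ k x i).1)
    (fun x => (a.integrable_and_integral_errorTerm hg hξ k x i).2)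
    (hmean.integrable_real_inner herr)
  simp_rw [a.randomState_succ_sub (hb k) F p]
  refine (integral_norm_add_add_sq_le hmean hnoise herr h1 h2).trans ?_
  have h3 := a.integral_norm_noiseTerm_sq_le hν (hσ k) hA i
  have h4 := a.integral_norm_errorTerm_sq_le hF hg hξ hν hξν (hb k) i
  gcongr

/-- The recursion of the mean-square distance to a common stationary point. -/
theorem exists_sum_integral_norm_sq_succ_le {G : SimpleGraph (Fin n)}
    (hA : IsCommunicationMatrix G a.A) (hF : ∀ i, IsSmoothStronglyConvex (F i) (L i) μ)
    (hg : ∀ i, IsStochasticGradient (𝒟 i) (F i) (g i) s) (hξ : IsSampling 𝒟 P ξ)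
    (hν : IsLaplaceNoise P σ ν)
    (hξν : IndepFun (fun ω k i l => ξ k i l ω) (fun ω k i => ν k i ω) P) (hσ : ∀ k, 0 < σ k)
    (hb : ∀ k, a.batch k ≠ 0) (hgrad : ∀ k, 0 ≤ a.gradStep k) (hmix : ∀ k, 0 < a.mixStep k)
    {p : Vec d} (hp : ∑ i, gradient (F i) p = 0) :
    ∃ B : ℝ, 0 ≤ B ∧ ∀ k, a.mixStep k ≤ 1 / 4 →
      ∑ i, ∫ ω, ‖a.randomState g ξ ν (k + 1) ω i - p‖ ^ 2 ∂P ≤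
        (1 - 2 * μ * a.gradStep k + B * a.gradStep k ^ 2)
            * ∑ i, ∫ ω, ‖a.randomState g ξ ν k ω i - p‖ ^ 2 ∂P
          + B * (a.gradStep k ^ 2 / a.mixStep k + a.gradStep k ^ 2
            + a.mixStep k ^ 2 * σ k ^ 2) := by
  obtain ⟨B, hB, hstep⟩ := exists_sum_norm_step_sq_le hA (g := fun i => gradient (F i))
    (fun i => (hF i).lipschitz) (fun i => (hF i).strong) hp
  -- The added constant bounds the two second moments summed over the `n` agents: `4 * d` for the
  -- Laplace noise, `2 * s ^ 2` for the gradient error.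
  refine ⟨B + n * (4 * d + 2 * s ^ 2), by positivity, fun k hk => ?_⟩
  set q := a.mixStep k
  set r := a.gradStep k
  have hr : 0 ≤ r := hgrad k
  have hq : 0 < q := hmix k
  have hX := a.memLp_randomState hF hg hξ hν hξν hσ hb k
  have hXp : ∀ i, Integrable (fun ω => ‖a.randomState g ξ ν k ω i - p‖ ^ 2) P := fun i =>
    ((hX i).sub (memLp_const p)).integrable_norm_sq
  have hmean : ∀ i, Integrable
      (fun ω => ‖a.meanStep F k p (a.randomState g ξ ν k ω) i‖ ^ 2) P := fun i =>
    (a.memLp_meanStep hF hX k p i).integrable_norm_sq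
  set W := ∑ i, ∫ ω, ‖a.randomState g ξ ν k ω i - p‖ ^ 2 ∂P
  have hW : 0 ≤ W := Finset.sum_nonneg fun i _ => integral_nonneg fun ω => by positivity
  have h1 : ∑ i, ∫ ω, ‖a.meanStep F k p (a.randomState g ξ ν k ω) i‖ ^ 2 ∂P ≤
      (1 - 2 * μ * r + B * r ^ 2) * W + B * (r ^ 2 / q + r ^ 2) := by
    rw [← integral_finsetSum _ fun i _ => hmean i]
    have h2 : (1 - 2 * μ * r + B * r ^ 2) * W + B * (r ^ 2 / q + r ^ 2)
        = ∫ ω, ((1 - 2 * μ * r + B * r ^ 2) * ∑ i, ‖a.randomState g ξ ν k ω i - p‖ ^ 2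
          + B * (r ^ 2 / q + r ^ 2)) ∂P := by
      rw [integral_add ((integrable_finsetSum _ fun i _ => hXp i).const_mul _)
        (integrable_const _), integral_const_mul, integral_finsetSum _ fun i _ => hXp i]
      simp [W]
    rw [h2]
    exact integral_mono (integrable_finsetSum _ fun i _ => hmean i)
      (((integrable_finsetSum _ fun i _ => hXp i).const_mul _).add (integrable_const _))
      fun ω => hstep r q hr hq hk (a.randomState g ξ ν k ω)
  have h3 := Finset.sum_le_sum fun i (_ : i ∈ Finset.univ) =>
    a.integral_norm_randomState_succ_sub_sq_le hA.doublyStochastic hF hg hξ hν hξν hσ hb p k i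
  rw [Finset.sum_add_distrib, Finset.sum_const, Finset.card_univ, Fintype.card_fin,
    nsmul_eq_mul] at h3
  refine h3.trans ?_
  set M : ℝ := n * (4 * d + 2 * s ^ 2) with hM
  have hM0 : 0 ≤ M := by positivity
  have h4 : (n : ℝ) * (2 * (q ^ 2 * (d * (2 * σ k ^ 2))) + 2 * (r ^ 2 * s ^ 2))
      ≤ M * (r ^ 2 + q ^ 2 * σ k ^ 2) := by
    have e1 : 0 ≤ (n : ℝ) * (4 * d) * r ^ 2 := by positivity
    have e2 : 0 ≤ (n : ℝ) * (2 * s ^ 2) * (q ^ 2 * σ k ^ 2) := by positivity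
    rw [hM]
    nlinarith
  have h5 : 0 ≤ M * r ^ 2 * W := by positivity
  have h6 : 0 ≤ M * (r ^ 2 / q) := by positivity
  have h7 : 0 ≤ B * (q ^ 2 * σ k ^ 2) := by positivity
  nlinarith

end Samples

end DPOpt.Alg

/-! ### Convergence -/

theorem DPOpt.Alg.tendsto_sum_integral_norm_sq {n d : ℕ} (a : Alg n d) {S : Fin n → Type*}
    [∀ i, MeasurableSpace (S i)] {g : ∀ i, Vec d → S i → Vec d} {Ω : Type*} [MeasurableSpace Ω]
    {P : Measure Ω} [IsProbabilityMeasure P] {ξ : ℕ → ∀ i, ℕ → Ω → S i}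
    {ν : ℕ → Fin n → Ω → Vec d} {𝒟 : ∀ i, Measure (S i)} [∀ i, IsProbabilityMeasure (𝒟 i)]
    {σ : ℕ → ℝ} {F : Fin n → Vec d → ℝ} {L : Fin n → ℝ} {μ s : ℝ} (hμ : 0 < μ)
    {G : SimpleGraph (Fin n)} (hA : IsCommunicationMatrix G a.A)
    (hF : ∀ i, IsSmoothStronglyConvex (F i) (L i) μ)
    (hg : ∀ i, IsStochasticGradient (𝒟 i) (F i) (g i) s) (hξ : IsSampling 𝒟 P ξ)
    (hν : IsLaplaceNoise P σ ν)
    (hξν : IndepFun (fun ω k i l => ξ k i l ω) (fun ω k i => ν k i ω) P) (hσ : ∀ k, 0 < σ k)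
    (hb : ∀ k, a.batch k ≠ 0) (hgrad : ∀ k, 0 < a.gradStep k) (hmix : ∀ k, 0 < a.mixStep k)
    (hgrad0 : Tendsto a.gradStep atTop (𝓝 0)) (hmix0 : Tendsto a.mixStep atTop (𝓝 0))
    (hratio : Tendsto (fun k => a.gradStep k / a.mixStep k) atTop (𝓝 0))
    (hnoise : Tendsto (fun k => a.mixStep k ^ 2 * σ k ^ 2 / a.gradStep k) atTop (𝓝 0))
    (hdiv : ¬ Summable a.gradStep) {p : Vec d} (hp : ∑ i, gradient (F i) p = 0) :
    Tendsto (fun k => ∑ i, ∫ ω, ‖a.randomState g ξ ν k ω i - p‖ ^ 2 ∂P) atTop (𝓝 0) := by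
  obtain ⟨B, hB, hrec⟩ := a.exists_sum_integral_norm_sq_succ_le hA hF hg hξ hν hξν hσ hb
    (fun k => (hgrad k).le) hmix hp
  have hW : ∀ k, 0 ≤ ∑ i, ∫ ω, ‖a.randomState g ξ ν k ω i - p‖ ^ 2 ∂P := fun k =>
    Finset.sum_nonneg fun i _ => integral_nonneg fun ω => by positivity
  have hlim : Tendsto (fun k => B / μ * (a.gradStep k / a.mixStep k + a.gradStep k
      + a.mixStep k ^ 2 * σ k ^ 2 / a.gradStep k)) atTop (𝓝 0) := by
    simpa using ((hratio.add hgrad0).add hnoise).const_mul (B / μ)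
  have hcμ : Tendsto (fun k => μ * a.gradStep k) atTop (𝓝 0) := by
    simpa using hgrad0.const_mul μ
  have hcB : Tendsto (fun k => B * a.gradStep k) atTop (𝓝 0) := by
    simpa using hgrad0.const_mul B
  -- Once `B * α_k ≤ μ`, the factor `1 - 2 μ α_k + B α_k²` is at most `1 - μ α_k`, whence `c k = μ
  -- α_k`; the source is written as `c k` times a null sequence.
  refine tendsto_zero_of_le_one_sub_mul_add hW (c := fun k => μ * a.gradStep k)
    (Eventually.of_forall fun k => (mul_pos hμ (hgrad k)).le)
    ((hcμ.eventually_lt_const one_pos).mono fun _ h => h.le)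
    (fun h => hdiv ((summable_mul_left_iff hμ.ne').1 h)) hlim ?_
  filter_upwards [hcB.eventually_lt_const hμ,
    hmix0.eventually_lt_const (by norm_num : (0 : ℝ) < 1 / 4)] with k h1 h2
  refine (hrec k h2.le).trans ?_
  have hr := hgrad k
  have hq := hmix k
  have h3 : μ * a.gradStep k * (B / μ * (a.gradStep k / a.mixStep k + a.gradStep k
      + a.mixStep k ^ 2 * σ k ^ 2 / a.gradStep k))
      = B * (a.gradStep k ^ 2 / a.mixStep k + a.gradStep k ^ 2
            + a.mixStep k ^ 2 * σ k ^ 2) := by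
    field_simp
  rw [h3]
  gcongr
  nlinarith

/-- The infinite-horizon private algorithm with increasing noise: mean-square convergence to the
minimizer together with a finite cumulative privacy budget. -/
theorem corollary1 {n d : ℕ}
    -- communication network
    (G : SimpleGraph (Fin n)) (a : Alg n d) (hA : IsCommunicationMatrix G a.A)
    -- local costs and their stochastic gradients
    {S : Fin n → Type*} [∀ i, MeasurableSpace (S i)]
    (𝒟 : ∀ i, Measure (S i)) [∀ i, IsProbabilityMeasure (𝒟 i)]
    (ℓ : ∀ i, Vec d → S i → ℝ) (hℓ : ∀ i x, Integrable (ℓ i x) (𝒟 i))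
    (L : Fin n → ℝ) (hL : ∀ i, 0 < L i) (μ : ℝ) (hμ : 0 < μ)
    (hf : ∀ i, IsSmoothStronglyConvex (localCost (𝒟 i) (ℓ i)) (L i) μ)
    (g : ∀ i, Vec d → S i → Vec d) (σg : ℝ) (hσg : 0 < σg)
    (hg : ∀ i, IsStochasticGradient (𝒟 i) (localCost (𝒟 i) (ℓ i)) (g i) σg)
    -- polynomial parameters
    (α β γ η a₁ a₂ a₃ b : ℝ)
    (ha₁ : 0 < a₁) (ha₁₂ : a₁ < a₂ ^ β) (ha₂ : 0 < a₂) (ha₃ : 0 < a₃) (hb : 0 < b)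
    (hsum : 1 < α + γ - β + η) (hβ : 0 < β) (hβα : β < α) (hα : α ≤ 1) (hγ : 0 ≤ γ)
    (hη : 0 ≤ η) (hηβ : η ≤ (3 * β - 2) / 2)
    (hgrad : ∀ k : ℕ, a.gradStep k = a₁ / ((k : ℝ) + a₂) ^ α)
    (hmix : ∀ k : ℕ, a.mixStep k = a₁ / ((k : ℝ) + a₂) ^ β)
    -- `⌈r⌉`, read as the least integer `≥ r` or as the least integer `> r`
    (hbatch : ∀ k : ℕ, a.batch k = ⌈a₃ * ((k : ℝ) + a₂) ^ γ⌉₊ ∨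
      a.batch k = ⌊a₃ * ((k : ℝ) + a₂) ^ γ⌋₊ + 1)
    (σ : ℕ → ℝ) (hσ : ∀ k : ℕ, σ k = b * ((k : ℝ) + a₂) ^ η)
    -- samples and privacy noises
    {Ω : Type*} [MeasurableSpace Ω] (P : Measure Ω) [IsProbabilityMeasure P]
    (ξ : ℕ → ∀ i, ℕ → Ω → S i) (hξ : IsSampling 𝒟 P ξ)
    (ν : ℕ → Fin n → Ω → Vec d) (hν : IsLaplaceNoise P σ ν)
    (hξν : IndepFun (fun ω k i l => ξ k i l ω) (fun ω k i => ν k i ω) P)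
    -- size of the change of a sampled gradient that is to be hidden
    (C : ℝ) (hC : 0 < C) :
    -- mean-square convergence to a common optimal solution
    (∃ xstar : Vec d,
      (∀ y, ∑ i, localCost (𝒟 i) (ℓ i) xstar ≤ ∑ i, localCost (𝒟 i) (ℓ i) y) ∧
      ∀ i,
        (∀ k, MemLp (fun ω =>
          a.iterate g (fun k i l => ξ k i l ω) (fun k j => ν k j ω) k i) 2 P) ∧
        Tendsto (fun k => ∫ ω,
          ‖a.iterate g (fun k i l => ξ k i l ω) (fun k j => ν k j ω) k i - xstar‖ ^ 2 ∂P)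
          atTop (𝓝 0)) ∧
    -- differential privacy with a finite cumulative privacy budget
    a.budget C σ < ⊤ ∧
    a.IsDifferentiallyPrivate P ν C (a.budget C σ).toReal := by
  have : NeZero n := ⟨by
    rintro rfl
    exact hA.connected.nonempty.elim fun i => i.elim0⟩
  have ht : ∀ k : ℕ, 0 < (k : ℝ) + a₂ := fun k => by positivity
  have hβ1 : β < 1 := hβα.trans_le hα
  have hσ0 : ∀ k, 0 < σ k := fun k => by rw [hσ]; have := ht k; positivity
  have hgrad0 : ∀ k, 0 < a.gradStep k := fun k => by rw [hgrad]; have := ht k; positivity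
  have hmix0 : ∀ k, 0 < a.mixStep k := fun k => by rw [hmix]; have := ht k; positivity
  have hmix1 : ∀ k, a.mixStep k ≤ 1 := fun k => by
    rw [hmix, div_le_one (Real.rpow_pos_of_pos (ht k) β)]
    refine ha₁₂.le.trans (Real.rpow_le_rpow ha₂.le ?_ hβ.le)
    have : (0 : ℝ) ≤ k := k.cast_nonneg
    linarith
  have hbatch_ge : ∀ k : ℕ, a₃ * ((k : ℝ) + a₂) ^ γ ≤ a.batch k := fun k => by
    rcases hbatch k with h | h
    · rw [h]
      exact Nat.le_ceil _
    · rw [h]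
      exact_mod_cast (Nat.lt_floor_add_one _).le
  have hbatch0 : ∀ k, a.batch k ≠ 0 := fun k h => by
    have h1 := hbatch_ge k
    have h2 : 0 < a₃ * ((k : ℝ) + a₂) ^ γ := by have := ht k; positivity
    rw [h, Nat.cast_zero] at h1
    linarith
  have hgrad_eq : a.gradStep = fun k : ℕ => a₁ * ((k : ℝ) + a₂) ^ (-α) := funext fun k => by
    rw [hgrad, Real.rpow_neg (ht k).le, div_eq_mul_inv]
  have hmix_eq : a.mixStep = fun k : ℕ => a₁ * ((k : ℝ) + a₂) ^ (-β) := funext fun k => by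
    rw [hmix, Real.rpow_neg (ht k).le, div_eq_mul_inv]
  have hbudget : a.budget C σ < ⊤ :=
    Alg.budget_lt_top_of_summable hC.le hmix1 (fun k => (hgrad0 k).le) hσ0
      (Alg.summable_sensitivityBound_div hC.le hmix1 ha₁ ha₂ ha₃ hb hsum hβα hβ1 hγ hgrad hmix
        hbatch_ge hσ)
  refine ⟨?_, hbudget, Alg.isDifferentiallyPrivate_of_budget_lt_top hC.le hmix1
    (fun k => (hgrad0 k).le) hν hσ0 hbudget⟩
  obtain ⟨p, hpmin, hp⟩ := exists_common_minimizer hL hμ hf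
  have hX := a.memLp_randomState hf hg hξ hν hξν hσ0 hbatch0
  have hlim := a.tendsto_sum_integral_norm_sq hμ hA hf hg hξ hν hξν hσ0 hbatch0 hgrad0 hmix0
    (by
      rw [hgrad_eq]
      simpa using (tendsto_natCast_add_rpow_zero a₂ (p := -α) (by linarith)).const_mul a₁)
    (by
      rw [hmix_eq]
      simpa using (tendsto_natCast_add_rpow_zero a₂ (p := -β) (by linarith)).const_mul a₁)
    (by
      refine (tendsto_natCast_add_rpow_zero a₂ (p := β - α) (by linarith)).congr fun k => ?_
      rw [hgrad, hmix, Real.rpow_sub (ht k)]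
      field_simp)
    (by
      -- The exponent of `β_k² σ_k² / α_k` is `-2β + 2η + α ≤ α + β - 2 < 0`; this is the place of
      -- the bound on `η`.
      have h1 := (tendsto_natCast_add_rpow_zero a₂ (p := -β + -β + (η + η) + α)
        (by linarith)).const_mul (a₁ * b ^ 2)
      rw [mul_zero] at h1
      refine h1.congr fun k => ?_
      rw [hgrad, hmix, hσ, Real.rpow_add (ht k), Real.rpow_add (ht k), Real.rpow_add (ht k),
        Real.rpow_add (ht k), Real.rpow_neg (ht k).le]
      field_simp)
    (by
      rw [hgrad_eq, summable_mul_left_iff ha₁.ne', summable_natCast_add_rpow ha₂]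
      exact hα.not_gt) hp
  refine ⟨p, hpmin, fun i => ⟨fun k => hX k i, ?_⟩⟩
  refine squeeze_zero (fun k => integral_nonneg fun ω => by positivity) (fun k => ?_) hlim
  exact Finset.single_le_sum
    (f := fun i => ∫ ω, ‖a.randomState g ξ ν k ω i - p‖ ^ 2 ∂P)
    (fun i _ => integral_nonneg fun ω => by positivity) (Finset.mem_univ i)
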